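/- **Definitions.** Trees over a ranked alphabet $\Sigma$ are strings: if $\sigma$ has rank $k$ and $t_1,\dots,t_k$ are trees, then $\sigma(t_1,\dots,t_k)$ is the string $\sigma t_1\cdots t_k$. A $k$-ary pattern is a tree over $\Sigma\cup\{x_1,\dots,x_k\}$ (the $x_i$ of rank $0$) in which each $x_i$ occurs exactly once. A *multiple context-free tree grammar* (MCFTG) $G=(N,\mathcal N,\Sigma,S,R)$ consists of a finite ranked alphabet $N$ of nonterminals; a finite set $\mathcal N$ of big nonterminals, which are nonempty repetition-free sequences $A=(A_1,\dots,A_n)$ over $N$, different ones having different sets of elements; a finite ranked alphabet $\Sigma$ of terminals, disjoint from $N$ and with at least one symbol of rank $\ge 1$; an initial nonterminal $S\in\mathcal N\cap N$ of rank $0$; and a finite set $R$ of rules $\rho=A\to(u,\mathcal L)$, where $A\in\mathcal N$, $u=(u_1,\dots,u_n)$ with $u_j$ a pattern over $N\cup\Sigma$ of arity $\mathrm{rk}(A_j)$, no nonterminal occurs more than once in $u$, and $\mathcal L\subseteq\mathcal N$ is a set of big nonterminals (the links) whose sets of elements partition the set of nonterminals occurring in $u$. Put $\mu(G)=\max\{|A|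 : A\in\mathcal N\}$ (multiplicity), $\mathrm{wid}(G)=\max\{\mathrm{rk}(C): C\in N\}$ (width) and $\lambda(G)=\max\{|\mathcal L| : A\to(u,\mathcal L)\in R\}$ (rule-width; $0$ if $R=\emptyset$). For each rule $\rho = A \to (u,\mathcal L)$ the links are listed in a fixed order $B_1,\dots,B_k$, and $\rho$ is given rank $k$. Derivation trees of type $A$ are the trees $\rho(d_1,\dots,d_k)$ over the ranked alphabet $R$ with $\rho=A\to(u,\{B_1,\dots,B_k\})$ and $d_i$ a derivation tree of type $B_i$; $L(G_{\mathrm{der}})$ is the set of derivation trees of type $S$. The value is $\mathrm{val}(\rho(d_1,\dots,d_k))=u[B_i\leftarrow\mathrm{val}(d_i)\mid 1\le i\le k]$ (second-order substitution: each node labeled by the $j$-th element of $B_i$ is replaced by the $j$-th pattern of $\mathrm{val}(d_i)$, with the subtrees of the node substituted for its variables). An $\mathrm{LDT^R}$-transducer is a linear deterministic top-down tree transducer with regular look-ahead (on the input subtree at the current node and on its direct subtrees). MCFTGs $G,G'$ are $\mathrm{LDT^R}$-equivalent if there are partial functions $M:T_R\to T_{R'}$ and $M':T_{R'}\to T_R$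 realized by $\mathrm{LDT^R}$-transducers such that, for all $d\in L(G_{\mathrm{der}})$ and $d'\in L(G'_{\mathrm{der}})$, $M(d)$ and $M'(d')$ are defined, $M(d)\in L(G'_{\mathrm{der}})$, $\mathrm{val}(M(d))=\mathrm{val}(d)$, $M'(d')\in L(G_{\mathrm{der}})$ and $\mathrm{val}(M'(d'))=\mathrm{val}(d')$. $G$ is *start-separated* if $S$ occurs in no right-hand side. For $\Delta\subseteq\Sigma$, $G$ is *$\Delta$-lexicalized* if a symbol of $\Delta$ occurs in the right-hand side of every rule, except possibly rules $S\to(u,\emptyset)$. A $k$-ary pattern is *footed* if $k=0$ or some node has rank $k$ and has the children $x_1,\dots,x_k$ in this order; $G$ is *footed* if all patterns in the right-hand sides of its rules are footed. A *multiple context-free grammar* (MCFG) over an unranked alphabet $\Sigma$ is a start-separated MCFTG with terminal alphabet $\Sigma\cup\{e\}$, where $e\notin\Sigma$ has rank $0$ and the symbols of $\Sigma$ have rank $1$, whose nonterminals other than $S$ have rank $1$, and whose nonterminal $S$ occurs in no big nonterminal other than $S$ itself. A string $w\in\Sigma^*$ is identified with the tree $we$; in particular, a tree $t$ over a ranked alphabet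 $\Sigma$, being a string, is identified with $te$. **Theorem.** Let $G$ be an MCFTG with terminal alphabet $\Sigma$. 1. There is an MCFG $G'$ over $\Sigma$ that is $\mathrm{LDT^R}$-equivalent to $G$ (each tree $t$ being identified with $te$), such that $\mu(G')=\mu(G)\cdot(\mathrm{wid}(G)+1)$ and $\lambda(G')=\lambda(G)$. Moreover, if $G$ is start-separated, then for every $\Delta\subseteq\Sigma$ such that $G$ is $\Delta$-lexicalized, $G'$ is $\Delta$-lexicalized. 2. If $G$ is footed, then there is an MCFG $G'$ over $\Sigma$ with all the properties of item 1, except that $\mu(G')=2\cdot\mu(G)$ instead of $\mu(G')=\mu(G)\cdot(\mathrm{wid}(G)+1)$. -/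

import Mathlib

/-- Trees over a ranked alphabet `(Ω, rk)` whose leaves may also be variables from `V`
(of rank 0). `RTree rk Empty` is the set of (ground) trees over `Ω`; `RTree rk (Fin k)` is the
set of trees with variables in `X_k`, where `var i` stands for the variable `x_{i+1}`. -/
inductive RTree {Ω : Type} (rk : Ω → ℕ) (V : Type) : Type
  | var (v : V) : RTree rk V
  | node (ω : Ω) (ts : Fin (rk ω) → RTree rk V) : RTree rk V

namespace RTree

variable {Ω Ω' : Type} {rk : Ω → ℕ} {rk' : Ω' → ℕ} {V W : Type}

/-- The occurrences of variables, from left to right. -/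
def vars : RTree rk V → List V
  | var v => [v]
  | node _ ts => (List.ofFn fun i => (ts i).vars).flatten

/-- The occurrences of symbols of the alphabet, in preorder. For a ground tree
`σ(t_1, …, t_k)` this is the string `σ t_1 ⋯ t_k`, i.e., the tree itself when trees are
defined as strings. -/
def symbols : RTree rk V → List Ω
  | var _ => []
  | node ω ts => ω :: (List.ofFn fun i => (ts i).symbols).flatten

/-- First-order substitution of trees for the variables. -/
def bind (f : V → RTree rk W) : RTree rk V → RTree rk W
  | var v => f v
  | node ω ts => node ω fun i => (ts i).bind f

/-- The tree `ω(x_1, …, x_k)`, where `k` is the rank of `ω`. -/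
def init (ω : Ω) : RTree rk (Fin (rk ω)) := node ω var

/-- The tree homomorphism determined by `h` (second-order substitution): every node with
label `ω` is replaced by `h ω`, into which the subtrees are substituted. -/
def hom (h : (ω : Ω) → RTree rk' (Fin (rk ω))) : RTree rk V → RTree rk' V
  | var v => var v
  | node ω ts => (h ω).bind fun i => (ts i).hom h

/-- A `k`-ary pattern: each of the variables `x_1, …, x_k` occurs exactly once. -/
def IsPattern {k : ℕ} (t : RTree rk (Fin k)) : Prop :=
  t.vars.Nodup ∧ ∀ i : Fin k, i ∈ t.vars

/-- `t` has a foot node: a node with label of rank `k` and children `x_1, …, x_k`, in this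
order. -/
def HasFoot {k : ℕ} : RTree rk (Fin k) → Prop
  | var _ => False
  | node ω ts =>
      (rk ω = k ∧ ∀ i : Fin (rk ω), ∃ j : Fin k, j.val = i.val ∧ ts i = var j) ∨
        ∃ i, (ts i).HasFoot

/-- Footed trees with variables in `X_k`; if `k = 0` then every tree is footed. -/
def IsFooted {k : ℕ} (t : RTree rk (Fin k)) : Prop := k = 0 ∨ t.HasFoot

/-- Ground trees over `T`, viewed as trees over the disjoint union of `N` and `T`. -/
def incl {N T : Type} (rkN : N → ℕ) {rkT : T → ℕ} {V : Type} :
    RTree rkT Empty → RTree (Sum.elim rkN rkT) V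
  | var v => v.elim
  | node a ts => node (rk := Sum.elim rkN rkT) (Sum.inr a) fun i => incl rkN (ts i)

end RTree

/-! ### Regular tree grammars -/

/-- A regular tree grammar in normal form: `rules A ω As` says that `A → ω(As 0, …, As (k-1))`
is a rule. -/
structure RTG {Ω : Type} (rk : Ω → ℕ) where
  N : Type
  finite_N : Finite N
  S : N
  rules : N → (ω : Ω) → (Fin (rk ω) → N) → Prop

/-- `H.Gen A t`: the nonterminal `A` generates the ground tree `t`. -/
inductive RTG.Gen {Ω : Type} {rk : Ω → ℕ} (H : RTG rk) : H.N → RTree rk Empty → Prop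
  | node (A : H.N) (ω : Ω) (As : Fin (rk ω) → H.N) (ts : Fin (rk ω) → RTree rk Empty)
      (hr : H.rules A ω As) (hts : ∀ i, H.Gen (As i) (ts i)) : H.Gen A (RTree.node ω ts)

/-- The generated tree language. -/
def RTG.language {Ω : Type} {rk : Ω → ℕ} (H : RTG rk) : Set (RTree rk Empty) :=
  {t | H.Gen H.S t}

/-- Regular tree languages. -/
def IsRegularTreeLanguage {Ω : Type} {rk : Ω → ℕ} (L : Set (RTree rk Empty)) : Prop :=
  ∃ H : RTG rk, L = H.language

/-! ### Linear deterministic top-down tree transducers with regular look-ahead -/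

/-- A transducer rule `⟨q, ω(y_1 : look 0, …, y_k : look (k-1)) : lookRoot⟩ → out` for a
given state `q` and a given input symbol `ω`. The right-hand side is a tree over the output
alphabet in which the pairs `⟨q, y_i⟩` may occur at leaves. -/
structure LDTRRule (Q : Type) {Ω Ω' : Type} (rk : Ω → ℕ) (rk' : Ω' → ℕ) (ω : Ω) where
  lookRoot : Set (RTree rk Empty)
  look : Fin (rk ω) → Set (RTree rk Empty)
  out : RTree rk' (Q × Fin (rk ω))

/-- Linear deterministic top-down tree transducers with regular look-ahead. -/
structure LDTR {Ω Ω' : Type} (rk : Ω → ℕ) (rk' : Ω' → ℕ) where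
  Q : Type
  finite_Q : Finite Q
  q₀ : Q
  rules : Q → (ω : Ω) → Set (LDTRRule Q rk rk' ω)
  finite_rules : ∀ q ω, (rules q ω).Finite
  regular : ∀ q ω, ∀ r ∈ rules q ω,
    IsRegularTreeLanguage r.lookRoot ∧ ∀ i, IsRegularTreeLanguage (r.look i)
  /-- Each input variable occurs at most once in a right-hand side. -/
  linear : ∀ q ω, ∀ r ∈ rules q ω, (r.out.vars.map Prod.snd).Nodup
  deterministic : ∀ q ω, ∀ r ∈ rules q ω, ∀ r' ∈ rules q ω, r ≠ r' →
    Disjoint r.lookRoot r'.lookRoot ∨ ∃ i, Disjoint (r.look i) (r'.look i)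

/-- `M.Translates q s t`: the `q`-translation of `s` is defined and equal to `t`. -/
inductive LDTR.Translates {Ω Ω' : Type} {rk : Ω → ℕ} {rk' : Ω' → ℕ} (M : LDTR rk rk') :
    M.Q → RTree rk Empty → RTree rk' Empty → Prop
  | step (q : M.Q) (ω : Ω) (ss : Fin (rk ω) → RTree rk Empty) (r : LDTRRule M.Q rk rk' ω)
      (hr : r ∈ M.rules q ω) (hroot : RTree.node ω ss ∈ r.lookRoot)
      (hlook : ∀ i, ss i ∈ r.look i) (g : M.Q × Fin (rk ω) → RTree rk' Empty)
      (hg : ∀ p ∈ r.out.vars, M.Translates p.1 (ss p.2) (g p)) :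
      M.Translates q (RTree.node ω ss) (r.out.bind g)

/-! ### Multiple context-free tree grammars -/

/-- A rule `A → (u, L)`. The left-hand side is the sequence `A = (A_1, …, A_n)`; the forest
`u = (u_1, …, u_n)` is given by `u_j = rhs A_j` (the sequence `A` will be repetition-free);
`links` lists the elements of `L` in their fixed linear order. -/
structure MCRule {N T : Type} (rkN : N → ℕ) (rkT : T → ℕ) where
  lhs : List N
  rhs : (C : N) → C ∈ lhs → RTree (Sum.elim rkN rkT) (Fin (rkN C))
  links : List (List N)

/-- All occurrences of nonterminals in the right-hand side forest. -/
def MCRule.nonterminals {N T : Type} {rkN : N → ℕ} {rkT : T → ℕ} (ρ : MCRule rkN rkT) :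
    List N :=
  (ρ.lhs.attach.flatMap fun C => (ρ.rhs C.1 C.2).symbols).filterMap Sum.getLeft?

/-- Multiple context-free tree grammars with terminal alphabet `(T, rkT)`. Nonterminals and
terminals are kept disjoint by using the disjoint union of `N` and `T`. -/
structure MCFTG {T : Type} (rkT : T → ℕ) where
  finite_T : Finite T
  /-- The maximal rank of the terminal symbols is at least 1. -/
  exists_rank_pos : ∃ a : T, 1 ≤ rkT a
  N : Type
  fintype_N : Fintype N
  rkN : N → ℕ
  /-- The big nonterminals. -/
  big : Finset (List N)
  big_ne_nil : ∀ A ∈ big, A ≠ []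
  big_nodup : ∀ A ∈ big, A.Nodup
  big_inj : ∀ A ∈ big, ∀ A' ∈ big, (∀ C, C ∈ A ↔ C ∈ A') → A = A'
  /-- The initial nonterminal. -/
  S : N
  S_big : [S] ∈ big
  S_rank : rkN S = 0
  rules : Finset (MCRule rkN rkT)
  lhs_big : ∀ ρ ∈ rules, ρ.lhs ∈ big
  rhs_pattern : ∀ ρ ∈ rules, ∀ C hC, (ρ.rhs C hC).IsPattern
  /-- The right-hand side is uniquely `N`-labeled. -/
  rhs_unique : ∀ ρ ∈ rules, ρ.nonterminals.Nodup
  links_big : ∀ ρ ∈ rules, ∀ B ∈ ρ.links, B ∈ big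
  /-- The links partition the nonterminals of the right-hand side (as links are nonempty,
  disjointness also says that no link is listed twice). -/
  links_disjoint : ∀ ρ ∈ rules, ρ.links.Pairwise List.Disjoint
  links_cover : ∀ ρ ∈ rules, ∀ C, C ∈ ρ.nonterminals ↔ ∃ B ∈ ρ.links, C ∈ B
  /-- `links` is a set of big nonterminals, listed in one fixed order: there are no two
  different rules that differ only in the order of the links. -/
  rules_ext : ∀ ρ ∈ rules, ∀ ρ' ∈ rules, ρ.lhs = ρ'.lhs →
    (∀ C hC hC', ρ.rhs C hC = ρ'.rhs C hC') → ρ.links.Perm ρ'.links → ρ = ρ'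

namespace MCFTG

variable {T : Type} {rkT : T → ℕ}

/-- The multiplicity: the maximal length of the big nonterminals. -/
def multiplicity (G : MCFTG rkT) : ℕ := G.big.sup List.length

/-- The width: the maximal rank of the nonterminals. -/
def width (G : MCFTG rkT) : ℕ :=
  letI := G.fintype_N
  (Finset.univ : Finset G.N).sup G.rkN

/-- The rule-width: the maximal number of links of the rules. -/
def ruleWidth (G : MCFTG rkT) : ℕ := G.rules.sup fun ρ => ρ.links.length

/-- The rules of `G`, as an alphabet of which each symbol `ρ` has the number of links of `ρ`
as its rank. -/
def RuleSym (G : MCFTG rkT) : Type := {ρ : MCRule G.rkN rkT // ρ ∈ G.rules}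

def ruleRk (G : MCFTG rkT) (ρ : G.RuleSym) : ℕ := ρ.1.links.length

/-- The derivation tree grammar of `G`. -/
def der (G : MCFTG rkT) : RTG G.ruleRk where
  N := {A : List G.N // A ∈ G.big}
  finite_N := inferInstance
  S := ⟨[G.S], G.S_big⟩
  rules A ρ Bs := ρ.1.lhs = A.1 ∧ ∀ i : Fin ρ.1.links.length, (Bs i).1 = ρ.1.links.get i

open Classical in
/-- The value of a derivation tree `d = ρ(d_1, …, d_k)` of type `A`, where `ρ` is the rule
`A → (u, {B_1, …, B_k})`: it is the forest `u[B_i ← val d_i | 1 ≤ i ≤ k]`. The forest is given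
by its component `val d C` for each nonterminal `C` that occurs in `A`; for the other
nonterminals, `val d C` is `C(x_1, …, x_m)`. -/
noncomputable def val (G : MCFTG rkT) :
    RTree G.ruleRk Empty → (C : G.N) → RTree (Sum.elim G.rkN rkT) (Fin (G.rkN C))
  | .var v => v.elim
  | .node ρ ds => fun C =>
      if hC : C ∈ ρ.1.lhs then
        (ρ.1.rhs C hC).hom fun ω => match ω with
          | Sum.inl D =>
              if hD : ∃ i : Fin ρ.1.links.length, D ∈ ρ.1.links.get i then
                G.val (ds hD.choose) D
              else RTree.init (rk := Sum.elim G.rkN rkT) (Sum.inl D)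
          | Sum.inr a => RTree.init (rk := Sum.elim G.rkN rkT) (Sum.inr a)
      else RTree.init (rk := Sum.elim G.rkN rkT) (Sum.inl C)

/-- The value of the derivation tree `d` of type `S` is the tree `t` over the terminal
alphabet. -/
def HasValue (G : MCFTG rkT) (d : RTree G.ruleRk Empty) (t : RTree rkT Empty) : Prop :=
  G.val d G.S = RTree.incl G.rkN t

/-- The initial nonterminal does not occur in the right-hand sides of rules. -/
def StartSeparated (G : MCFTG rkT) : Prop := ∀ ρ ∈ G.rules, G.S ∉ ρ.nonterminals

/-- A rule is proper if it is not both initial and terminal. -/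
def IsProper (G : MCFTG rkT) (ρ : MCRule G.rkN rkT) : Prop :=
  ¬ (ρ.lhs = [G.S] ∧ ρ.links = [])

/-- Every proper rule has a symbol from `Δ` in its right-hand side. -/
def IsLexicalized (G : MCFTG rkT) (Δ : Set T) : Prop :=
  ∀ ρ ∈ G.rules, G.IsProper ρ → ∃ C hC, ∃ a ∈ Δ, Sum.inr a ∈ (ρ.rhs C hC).symbols

/-- Footed grammars (non-strict multi-component tree adjoining grammars). -/
def IsFooted (G : MCFTG rkT) : Prop := ∀ ρ ∈ G.rules, ∀ C hC, (ρ.rhs C hC).IsFooted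

/-- One half of the equivalence below: `M` translates every derivation tree `d` of `G` with
value `t` into a derivation tree of `G'` with a value `t'` such that `P t t'`. -/
def TranslatesDerivations {T' : Type} {rkT' : T' → ℕ} (G : MCFTG rkT) (G' : MCFTG rkT')
    (P : RTree rkT Empty → RTree rkT' Empty → Prop) (M : LDTR G.ruleRk G'.ruleRk) : Prop :=
  ∀ d ∈ G.der.language, ∃ d' ∈ G'.der.language, M.Translates M.q₀ d d' ∧
    ∃ t t', G.HasValue d t ∧ G'.HasValue d' t' ∧ P t t'

/-- `G'` is LDT^R-`φ`-equivalent to `G`. -/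
def LDTREquivalent {T' : Type} {rkT' : T' → ℕ} (φ : RTree rkT Empty → RTree rkT' Empty)
    (G : MCFTG rkT) (G' : MCFTG rkT') : Prop :=
  (∃ M : LDTR G.ruleRk G'.ruleRk, TranslatesDerivations G G' (fun t t' => t' = φ t) M) ∧
    ∃ M' : LDTR G'.ruleRk G.ruleRk, TranslatesDerivations G' G (fun t' t => φ t = t') M'

end MCFTG

/-! ### Multiple context-free (string) grammars -/

/-- The ranks of the monadic alphabet that has all symbols of `T`, now with rank 1, and the
special symbol `e` (here `none`) of rank 0. -/
def monadicRk (T : Type) : Option T → ℕ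
  | none => 0
  | some _ => 1

/-- The string `w`, identified with the monadic tree `w e`. -/
def monadicTree {T : Type} : List T → RTree (monadicRk T) Empty
  | [] => RTree.node none fun i => Fin.elim0 i
  | a :: w => RTree.node (some a) fun _ => monadicTree w

/-- The tree `t`, which is a string, identified with the monadic tree `t e`. -/
def treeAsString {T : Type} {rkT : T → ℕ} (t : RTree rkT Empty) : RTree (monadicRk T) Empty :=
  monadicTree t.symbols

/-- Multiple context-free grammars over the (unranked) alphabet `T`: start-separated MCFTGs
over the monadic alphabet in which each nonterminal has rank 1, except for the initial
nonterminal, which has rank 0 and is not part of any other big nonterminal. -/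
def MCFTG.IsMCFG {T : Type} (G : MCFTG (monadicRk T)) : Prop :=
  (∀ C : G.N, C ≠ G.S → G.rkN C = 1) ∧ (∀ A ∈ G.big, G.S ∈ A → A = [G.S]) ∧ G.StartSeparated

/-! In Polish notation a pattern of rank k is a string w_0 x_{π(1)} w_1 ⋯ x_{π(k)} w_k, where the
w_j contain no variables. It can thus be represented by k + 1 strings together with the order π,
which is finite information and can be guessed in the nonterminals. If all patterns are footed, then
x_1 ⋯ x_k stays one contiguous block, and two strings suffice. A `ShapeSystem` covers both cases:
shapes are sequences of at most `b` blocks of variables, closed under the rules, and the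
multiplicity grows by the factor b + 1.

A rule of the MCFG is a rule of `G` with shapes for its links. Each nonterminal in the right-hand
side is expanded into its components, separated by the blocks of its shape. By closure the resulting
word again has an allowed shape, and the strings between its blocks are the new right-hand sides.
Each link yields one link, so the rule-width is kept.

Values correspond because the map from trees to words turns second-order substitution into
composition of homomorphisms (`RTree.word_hom`, `exists_val_node`). Erasing shapes from a derivation
tree gives one of `G`. Conversely, a finite bottom-up automaton computes the shapes, so look-ahead
on the direct subtrees restores them (`exists_decode`, `exists_encode`).

Three points need care. Distinct typed rules must remain distinct up to the order of links, which
follows from unique readability (`RTree.word_append_inj`, `rule_inj`). The multiplicity must be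
attained exactly, hence a big nonterminal without rules. The initial nonterminal is new, so rules
for `G.S` may be needed in two copies; the second is dropped if `G` is start-separated, as it could
violate lexicalization. -/

/-! ### Words with variables -/

/-- Words over the letters `X` and the variables `V`. -/
abbrev Word (X V : Type) := List (X ⊕ V)

namespace Word

variable {X Y V W : Type}

/-- Substitution of words for the variables. -/
def bind (f : V → Word X W) (l : Word X V) : Word X W :=
  l.flatMap (Sum.elim (fun x => [Sum.inl x]) f)

/-- Substitution of words without variables for the letters. -/
def mapLetters (θ : X → List Y) (l : Word X V) : Word Y V :=
  l.flatMap (Sum.elim (fun x => (θ x).map Sum.inl) fun v => [Sum.inr v])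

/-- The letters of a word, from left to right. -/
def letters (l : Word X V) : List X := l.filterMap Sum.getLeft?

/-- The variables of a word, from left to right. -/
def vars (l : Word X V) : List V := l.filterMap Sum.getRight?

@[simp] theorem bind_nil (f : V → Word X W) : bind f [] = [] := rfl
@[simp] theorem bind_inl (f : V → Word X W) (x : X) (l : Word X V) :
    bind f (Sum.inl x :: l) = Sum.inl x :: bind f l := rfl
@[simp] theorem bind_inr (f : V → Word X W) (v : V) (l : Word X V) :
    bind f (Sum.inr v :: l) = f v ++ bind f l := rfl

@[simp] theorem mapLetters_nil (θ : X → List Y) : mapLetters θ ([] : Word X V) = [] := rfl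
@[simp] theorem mapLetters_inl (θ : X → List Y) (x : X) (l : Word X V) :
    mapLetters θ (Sum.inl x :: l) = (θ x).map Sum.inl ++ mapLetters θ l := rfl
@[simp] theorem mapLetters_inr (θ : X → List Y) (v : V) (l : Word X V) :
    mapLetters θ (Sum.inr v :: l) = Sum.inr v :: mapLetters θ l := rfl
@[simp] theorem mapLetters_append (θ : X → List Y) (l l' : Word X V) :
    mapLetters θ (l ++ l') = mapLetters θ l ++ mapLetters θ l' := List.flatMap_append

@[simp] theorem letters_nil : letters ([] : Word X V) = [] := rfl
@[simp] theorem letters_inl (x : X) (l : Word X V) :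
    letters (Sum.inl x :: l) = x :: letters l := rfl
@[simp] theorem letters_inr (v : V) (l : Word X V) : letters (Sum.inr v :: l) = letters l := rfl
@[simp] theorem letters_append (l l' : Word X V) :
    letters (l ++ l') = letters l ++ letters l' := List.filterMap_append
@[simp] theorem letters_map_inl (l : List X) : letters (l.map Sum.inl : Word X V) = l := by
  induction l <;> simp_all
@[simp] theorem letters_map_inr (l : List V) : letters (l.map Sum.inr : Word X V) = [] := by
  induction l <;> simp_all

@[simp] theorem vars_nil : vars ([] : Word X V) = [] := rfl
@[simp] theorem vars_inl (x : X) (l : Word X V) : vars (Sum.inl x :: l) = vars l := rfl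
@[simp] theorem vars_inr (v : V) (l : Word X V) : vars (Sum.inr v :: l) = v :: vars l := rfl
@[simp] theorem vars_append (l l' : Word X V) : vars (l ++ l') = vars l ++ vars l' :=
  List.filterMap_append
@[simp] theorem vars_map_inl (l : List X) : vars (l.map Sum.inl : Word X V) = [] := by
  induction l <;> simp_all
@[simp] theorem vars_map_inr (l : List V) : vars (l.map Sum.inr : Word X V) = l := by
  induction l <;> simp_all

theorem vars_bind (f : V → Word X W) (l : Word X V) :
    vars (bind f l) = (vars l).flatMap fun v => vars (f v) := by
  induction l with
  | nil => rfl
  | cons z l ih => cases z <;> simp [ih]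

theorem letters_bind (f : V → Word X W) (l : Word X V) :
    (letters (bind f l)).Perm (letters l ++ (vars l).flatMap fun v => letters (f v)) := by
  induction l with
  | nil => simp
  | cons z l ih =>
    cases z with
    | inl x => simpa using ih
    | inr v =>
      simp only [bind_inr, letters_append, letters_inr, vars_inr, List.flatMap_cons]
      refine (List.Perm.append_left _ ih).trans ?_
      rw [← List.append_assoc, ← List.append_assoc]
      exact List.Perm.append_right _ List.perm_append_comm

theorem bind_append (f : V → Word X W) (l l' : Word X V) :
    bind f (l ++ l') = bind f l ++ bind f l' := List.flatMap_append

theorem bind_bind {U : Type} (f : V → Word X W) (g : W → Word X U) (l : Word X V) :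
    bind g (bind f l) = bind (fun v => bind g (f v)) l := by
  induction l with
  | nil => rfl
  | cons z l ih => cases z <;> simp [ih, bind_append]

theorem mapLetters_bind (θ : X → List Y) (f : V → Word X W) (l : Word X V) :
    mapLetters θ (bind f l) = bind (fun v => mapLetters θ (f v)) (mapLetters θ l) := by
  induction l with
  | nil => rfl
  | cons z l ih =>
    cases z with
    | inl x =>
      simp only [bind_inl, mapLetters_inl, ih, bind_append, List.append_left_inj]
      induction θ x <;> simp_all
    | inr v => simp [ih]

@[simp] theorem bind_map_inr (f : V → Word X W) (l : List V) :
    bind f (l.map Sum.inr) = l.flatMap f := by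
  induction l <;> simp_all

theorem mem_vars {v : V} {l : Word X V} : v ∈ vars l ↔ Sum.inr v ∈ l := by
  simp [vars, Sum.getRight?_eq_some_iff]

/-- The word `w_0 b_1 w_1 ⋯ b_m w_m`, where `s = [b_1, …, b_m]`. -/
def interleave : (ℕ → List X) → List (List V) → Word X V
  | w, [] => (w 0).map Sum.inl
  | w, b :: s => (w 0).map Sum.inl ++ b.map Sum.inr ++ interleave (fun j => w (j + 1)) s

theorem mapLetters_interleave (θ : X → List Y) (w : ℕ → List X) (s : List (List V)) :
    mapLetters θ (interleave w s) = interleave (fun j => (w j).flatMap θ) s := by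
  have h (l : List X) : mapLetters θ (l.map Sum.inl : Word X V) = (l.flatMap θ).map Sum.inl := by
    induction l <;> simp_all
  have h' (l : List V) : mapLetters θ (l.map Sum.inr : Word X V) = l.map Sum.inr := by
    induction l <;> simp_all
  induction s generalizing w with
  | nil => simp [interleave, h]
  | cons b s ih => simp [interleave, h, h', ih]

theorem interleave_congr {w w' : ℕ → List X} {s : List (List V)}
    (h : ∀ j ≤ s.length, w j = w' j) : interleave w s = interleave w' s := by
  induction s generalizing w w' with
  | nil => simp [interleave, h 0]
  | cons b s ih =>
    simp only [interleave, h 0 (Nat.zero_le _)]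
    rw [ih fun j hj => h (j + 1) (by simpa using hj)]

@[simp] theorem vars_interleave (w : ℕ → List X) (s : List (List V)) :
    vars (interleave w s) = s.flatten := by
  induction s generalizing w <;> simp_all [interleave]

theorem letters_interleave (w : ℕ → List X) (s : List (List V)) :
    letters (interleave w s) = (List.range (s.length + 1)).flatMap w := by
  induction s generalizing w with
  | nil => simp [interleave]
  | cons b s ih =>
    rw [List.length_cons, List.range_succ_eq_map]
    simp [interleave, ih, List.flatMap_map]

/-- Every word is an interleaving with blocks of length one. -/
theorem exists_eq_interleave (l : Word X V) :
    ∃ w : ℕ → List X, l = interleave w ((vars l).map fun v => [v]) := by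
  induction l with
  | nil => exact ⟨fun _ => [], rfl⟩
  | cons z l ih =>
    obtain ⟨w, hw⟩ := ih
    cases z with
    | inl x =>
      refine ⟨fun j => if j = 0 then x :: w 0 else w j, ?_⟩
      conv_lhs => rw [hw]
      rw [vars_inl]
      cases vars l <;> simp [interleave]
    | inr v =>
      refine ⟨fun j => j.casesOn [] w, ?_⟩
      conv_lhs => rw [hw]
      simp [interleave]

end Word

/-! ### Homomorphisms from trees to words, and unique readability. -/

namespace RTree

variable {Ω Ω' X Y V W : Type} {rk : Ω → ℕ} {rk' : Ω' → ℕ}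

theorem vars_node (ω : Ω) (ts : Fin (rk ω) → RTree rk V) :
    (node ω ts).vars = (List.finRange (rk ω)).flatMap fun i => (ts i).vars := by
  rw [vars, List.ofFn_eq_map, List.flatMap_def]

theorem symbols_node (ω : Ω) (ts : Fin (rk ω) → RTree rk V) :
    (node ω ts).symbols = ω :: (List.finRange (rk ω)).flatMap fun i => (ts i).symbols := by
  rw [symbols, List.ofFn_eq_map, List.flatMap_def]

/-- The homomorphism from trees to words determined by `E`. -/
def word (E : (ω : Ω) → Word X (Fin (rk ω))) : RTree rk V → Word X V
  | var v => [Sum.inr v]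
  | node ω ts => Word.bind (fun i => (ts i).word E) (E ω)

theorem word_bind (E : (ω : Ω) → Word X (Fin (rk ω))) (f : V → RTree rk W) (t : RTree rk V) :
    (t.bind f).word E = Word.bind (fun v => (f v).word E) (t.word E) := by
  induction t with
  | var v => simp [RTree.bind, word]
  | node ω ts ih => simp [RTree.bind, word, Word.bind_bind, ih]

/-- Substituting patterns into a tree becomes composition of homomorphisms into words; this is how
values of derivation trees are computed as strings. -/
theorem word_hom (E : (ω : Ω') → Word X (Fin (rk' ω))) (h : (ω : Ω) → RTree rk' (Fin (rk ω)))
    (t : RTree rk V) : (t.hom h).word E = t.word fun ω => (h ω).word E := by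
  induction t with
  | var v => rfl
  | node ω ts ih => simp [hom, word, word_bind, ih]

theorem word_mapLetters (E : (ω : Ω) → Word X (Fin (rk ω))) (θ : X → List Y) (t : RTree rk V) :
    (t.word fun ω => Word.mapLetters θ (E ω)) = Word.mapLetters θ (t.word E) := by
  induction t with
  | var v => rfl
  | node ω ts ih => simp [word, Word.mapLetters_bind, ih]

theorem word_congr {E E' : (ω : Ω) → Word X (Fin (rk ω))} {t : RTree rk V}
    (h : ∀ ω ∈ t.symbols, E ω = E' ω) : t.word E = t.word E' := by
  induction t with
  | var v => rfl
  | node ω ts ih =>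
    rw [symbols_node] at h
    have h' (i) : (ts i).word E = (ts i).word E' :=
      ih i fun ω hω => h ω (List.mem_cons_of_mem _
        (List.mem_flatMap.2 ⟨i, List.mem_finRange i, hω⟩))
    simp [word, h', h ω]

theorem vars_word {E : (ω : Ω) → Word X (Fin (rk ω))}
    (hE : ∀ ω, (E ω).vars.Perm (List.finRange (rk ω))) (t : RTree rk V) :
    (t.word E).vars.Perm t.vars := by
  induction t with
  | var v => simp [word, vars]
  | node ω ts ih =>
    rw [word, Word.vars_bind, vars_node]
    exact ((hE ω).flatMap_right _).trans (List.Perm.flatMap_left _ fun i _ => ih i)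

/-- Each `E ω` contains each of its variables exactly once, so no subtree is deleted or copied and
letters are only rearranged. -/
theorem letters_word {E : (ω : Ω) → Word X (Fin (rk ω))}
    (hE : ∀ ω, (E ω).vars.Perm (List.finRange (rk ω))) (t : RTree rk V) :
    (t.word E).letters.Perm (t.symbols.flatMap fun ω => (E ω).letters) := by
  induction t with
  | var v => simp [word, symbols]
  | node ω ts ih =>
    rw [word, symbols_node, List.flatMap_cons, List.flatMap_assoc]
    exact (Word.letters_bind _ _).trans (List.Perm.append_left _
      (((hE ω).flatMap_right _).trans (List.Perm.flatMap_left _ fun i _ => ih i)))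

/-- Unique readability: the first letter determines the root symbol `ω`, and `E ω` then tells where
each subtree is read. The remainders `r` and `r'` are needed in the induction, since the word of a
subtree is followed by other text. -/
theorem word_append_inj {E : (ω : Ω) → Word X (Fin (rk ω))} {p : Ω → Prop}
    (hE : ∀ ω, (E ω).vars.Perm (List.finRange (rk ω)))
    (hp : ∀ ω, p ω → ∃ x l, E ω = Sum.inl x :: l ∧ ∀ ω' l', p ω' → E ω' = Sum.inl x :: l' → ω = ω')
    {t t' : RTree rk V} {r r' : Word X V} (ht : ∀ ω ∈ t.symbols, p ω)
    (ht' : ∀ ω ∈ t'.symbols, p ω) (h : t.word E ++ r = t'.word E ++ r') : t = t' ∧ r = r' := by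
  induction t generalizing t' r r' with
  | var v =>
    cases t' with
    | var v' => simpa [word] using h
    | node ω ts =>
      obtain ⟨x, l, hl, -⟩ := hp ω (ht' ω (by simp [symbols]))
      simp [word, hl] at h
  | node ω ts ih =>
    obtain ⟨x, l, hl, hx⟩ := hp ω (ht ω (by simp [symbols]))
    cases t' with
    | var v' => simp [word, hl] at h
    | node ω' ts' =>
      obtain ⟨x', l', hl', -⟩ := hp ω' (ht' ω' (by simp [symbols]))
      have hxx : x = x' := by
        simp only [word, hl, hl', Word.bind_inl, List.cons_append, List.cons.injEq] at h
        exact Sum.inl_injective h.1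
      subst hxx
      obtain rfl := hx ω' l' (ht' ω' (by simp [symbols])) hl'
      rw [symbols_node] at ht ht'
      have hs (i) : ∀ ω ∈ (ts i).symbols, p ω := fun ω hω => ht ω (List.mem_cons_of_mem _
        (List.mem_flatMap.2 ⟨i, List.mem_finRange i, hω⟩))
      have hs' (i) : ∀ ω ∈ (ts' i).symbols, p ω := fun ω hω => ht' ω (List.mem_cons_of_mem _
        (List.mem_flatMap.2 ⟨i, List.mem_finRange i, hω⟩))
      -- Both sides are read along the same word `l`; at a variable, the induction hypothesis is
      -- applied with the unread rest as remainder.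
      have key (l : Word X (Fin (rk ω))) (h : Word.bind (fun i => (ts i).word E) l ++ r =
          Word.bind (fun i => (ts' i).word E) l ++ r') :
          (∀ i ∈ l.vars, ts i = ts' i) ∧ r = r' := by
        induction l with
        | nil => simpa using h
        | cons z l ihl =>
          cases z with
          | inl x => exact ihl (by simpa using h)
          | inr i =>
            simp only [Word.bind_inr, List.append_assoc] at h
            obtain ⟨h₁, h₂⟩ := ih i (hs i) (hs' i) h
            obtain ⟨h₃, h₄⟩ := ihl h₂
            exact ⟨by simpa [h₁] using h₃, h₄⟩
      obtain ⟨h₁, h₂⟩ := key (E ω) h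
      refine ⟨?_, h₂⟩
      congr 1
      funext i
      exact h₁ i ((hE ω).mem_iff.2 (List.mem_finRange i))

/-- The letter `ω`, followed by its variables: the homomorphism to the preorder word. -/
def preorder (ω : Ω) : Word Ω (Fin (rk ω)) := Sum.inl ω :: (List.finRange (rk ω)).map Sum.inr

theorem letters_word_preorder (t : RTree rk V) : (t.word preorder).letters = t.symbols := by
  have h (k : ℕ) (f : Fin k → Word Ω V) (l : List (Fin k)) :
      Word.letters (l.flatMap f) = l.flatMap fun i => (f i).letters := by
    induction l <;> simp_all
  induction t with
  | var v => rfl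
  | node ω ts ih => simp [word, preorder, symbols_node, h, ih]

@[simp] theorem symbols_incl {N T : Type} (rkN : N → ℕ) {rkT : T → ℕ} (t : RTree rkT Empty) :
    (incl (V := V) rkN t).symbols = t.symbols.map Sum.inr := by
  induction t with
  | var v => exact v.elim
  | node a ts ih =>
    rw [incl, symbols_node, symbols_node]
    simp [ih, List.map_flatMap]

theorem exists_eq_incl {N T : Type} (rkN : N → ℕ) {rkT : T → ℕ} [IsEmpty V]
    (t : RTree (Sum.elim rkN rkT) V) (ht : ∀ D, Sum.inl D ∉ t.symbols) :
    ∃ t₀ : RTree rkT Empty, t = incl rkN t₀ := by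
  induction t with
  | var v => exact isEmptyElim v
  | node ω ts ih =>
    rw [symbols_node] at ht
    cases ω with
    | inl D => exact absurd List.mem_cons_self (ht D)
    | inr a =>
      have h (i) : ∃ t₀ : RTree rkT Empty, ts i = incl rkN t₀ := ih i fun D hD =>
        ht D (List.mem_cons_of_mem _ (List.mem_flatMap.2 ⟨i, List.mem_finRange i, hD⟩))
      choose g hg using h
      exact ⟨node a g, congrArg (node (rk := Sum.elim rkN rkT) (Sum.inr a)) (funext hg)⟩

end RTree

/-! ### Shape systems and the construction of the MCFG -/

namespace MCFTG

variable {T : Type} {rkT : T → ℕ}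

instance (G : MCFTG rkT) : Finite G.N := @Finite.of_fintype _ G.fintype_N

instance (G : MCFTG rkT) : Finite G.RuleSym :=
  inferInstanceAs (Finite {ρ : MCRule G.rkN rkT // ρ ∈ G.rules})

/-- A shape `[b_1, …, b_m]` of a pattern prescribes that the pattern is a word of the form
`w_0 b_1 w_1 ⋯ b_m w_m`, where the `w_j` contain no variables. A shape system consists of
finitely many shapes for each nonterminal, such that the right-hand sides of the rules have one
of these shapes whenever this holds for the patterns that are substituted into them. -/
structure ShapeSystem (G : MCFTG rkT) (b : ℕ) where
  shapes : (C : G.N) → Set (List (List (Fin (G.rkN C))))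
  finite : ∀ C, (shapes C).Finite
  nonempty : ∀ C, (shapes C).Nonempty
  perm : ∀ C, ∀ s ∈ shapes C, s.flatten.Perm (List.finRange (G.rkN C))
  length_le : ∀ C, ∀ s ∈ shapes C, s.length ≤ b
  nil_of_start : ∀ s ∈ shapes G.S, s = []
  exists_interleave : ∀ ρ ∈ G.rules, ∀ C hC, ∀ (X : Type)
    (E : (ω : G.N ⊕ T) → Word X (Fin (Sum.elim G.rkN rkT ω))),
    (∀ D, ∃ s ∈ shapes D, ∃ w, E (Sum.inl D) = Word.interleave w s) →
    (∀ a, ∃ x, E (Sum.inr a) = Sum.inl x :: (List.finRange (rkT a)).map Sum.inr) →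
    ∃ s ∈ shapes C, ∃ w, (ρ.rhs C hC).word E = Word.interleave w s

/-! ### Nonterminals, big nonterminals and typed rules of the MCFG. -/

namespace ShapeSystem

variable {G : MCFTG rkT} {b : ℕ} (H : G.ShapeSystem b)

/-- Assignments of a shape to each nonterminal. -/
def Assignment : Type := (C : G.N) → H.shapes C

instance : Finite H.Assignment := by
  have (C : G.N) : Finite (H.shapes C) := (H.finite C).to_subtype
  exact inferInstanceAs (Finite ((C : G.N) → H.shapes C))

/-- An arbitrary shape assignment. -/
noncomputable def someShape : H.Assignment := fun C => ⟨_, (H.nonempty C).some_mem⟩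

/-- A component `(A, τ, C, j)` stands for the `j`-th word of the pattern generated by `C`, as
element of `A`, when the patterns generated by `A` have the shapes `τ`. -/
abbrev Comp : Type := {A : List G.N // A ∈ G.big} × H.Assignment × G.N × Fin (b + 1)

/-- The nonterminals of the MCFG: the initial nonterminal, the elements of a big nonterminal
without rules that attains the multiplicity, and the components. -/
abbrev Nt : Type := Unit ⊕ Fin (G.multiplicity * (b + 1)) ⊕ H.Comp

/-- The initial nonterminal has rank 0, all others have rank 1. -/
def ntRk : H.Nt → ℕ
  | Sum.inl _ => 0
  | Sum.inr _ => 1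

/-- The right-hand sides of the rules of the MCFG are trees over this alphabet. -/
abbrev MTree (V : Type) : Type := RTree (Sum.elim H.ntRk (monadicRk T)) V

/-- The monadic tree with the symbols `w` above `t`. -/
def wordTree {V : Type} (w : List (H.Comp ⊕ T)) (t : H.MTree V) : H.MTree V :=
  match w with
  | [] => t
  | Sum.inl y :: w =>
      .node (rk := Sum.elim H.ntRk (monadicRk T)) (Sum.inl (Sum.inr (Sum.inr y)))
        fun _ => wordTree w t
  | Sum.inr a :: w =>
      .node (rk := Sum.elim H.ntRk (monadicRk T)) (Sum.inr (some a)) fun _ => wordTree w t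

/-- The unique tree without letters. -/
def endTree : (c : H.Nt) → H.MTree (Fin (H.ntRk c))
  | Sum.inl _ => .node (rk := Sum.elim H.ntRk (monadicRk T)) (Sum.inr none) Fin.elim0
  | Sum.inr _ => .var (0 : Fin 1)

theorem vars_wordTree {V : Type} (w : List (H.Comp ⊕ T)) (t : H.MTree V) :
    (H.wordTree w t).vars = t.vars := by
  induction w with
  | nil => rfl
  | cons z w ih =>
    cases z <;> rw [wordTree, RTree.vars_node] <;> simp only [ih] <;>
      simp [ntRk, monadicRk, List.finRange_succ]

theorem symbols_wordTree {V : Type} (w : List (H.Comp ⊕ T)) (t : H.MTree V) :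
    (H.wordTree w t).symbols = w.map (Sum.map (Sum.inr ∘ Sum.inr) some) ++ t.symbols := by
  induction w with
  | nil => rfl
  | cons z w ih =>
    cases z <;> rw [wordTree, RTree.symbols_node] <;> simp only [ih] <;>
      simp [ntRk, monadicRk, List.finRange_succ]

theorem isPattern_wordTree (w : List (H.Comp ⊕ T)) (c : H.Nt) :
    (H.wordTree w (H.endTree c)).IsPattern := by
  rw [RTree.IsPattern, vars_wordTree]
  cases c with
  | inl _ => exact ⟨by simp [endTree, RTree.vars, monadicRk], fun i => i.elim0⟩
  | inr _ => exact ⟨List.nodup_singleton _,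
      fun i => List.mem_singleton.2 (Subsingleton.elim (α := Fin 1) i 0)⟩

theorem letters_endTree (c : H.Nt) :
    (H.endTree c).symbols.filterMap Sum.getLeft? = [] := by
  cases c <;> simp [endTree, RTree.symbols, monadicRk]

theorem wordTree_injective {c : H.Nt} {w w' : List (H.Comp ⊕ T)}
    (h : H.wordTree w (H.endTree c) = H.wordTree w' (H.endTree c)) : w = w' := by
  have h₁ := congrArg RTree.symbols h
  rw [symbols_wordTree, symbols_wordTree, List.append_left_inj] at h₁
  refine List.map_injective_iff.2 (Sum.map_injective.2 ⟨?_, Option.some_injective _⟩) h₁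
  exact Sum.inr_injective.comp Sum.inr_injective

/-- A rule of `G`, together with shapes for its links. -/
def TypedRule : Type := (ρ : G.RuleSym) × (Fin (G.ruleRk ρ) → H.Assignment)

instance : Finite H.TypedRule :=
  inferInstanceAs (Finite ((ρ : G.RuleSym) × (Fin (G.ruleRk ρ) → H.Assignment)))

variable {H}

namespace TypedRule

variable (r : H.TypedRule)

/-- The links of the underlying rule. -/
def link (i : Fin (G.ruleRk r.1)) : {A : List G.N // A ∈ G.big} :=
  ⟨r.1.1.links.get i, G.links_big _ r.1.2 _ (List.get_mem _ _)⟩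

/-- The left-hand side of the underlying rule. -/
def lhs : {A : List G.N // A ∈ G.big} := ⟨r.1.1.lhs, G.lhs_big _ r.1.2⟩

theorem link_unique {i j : Fin (G.ruleRk r.1)} {D : G.N} (hi : D ∈ (r.link i).1)
    (hj : D ∈ (r.link j).1) : i = j := by
  by_contra hij
  have h := List.pairwise_iff_get.1 (G.links_disjoint _ r.1.2)
  rcases lt_or_gt_of_ne hij with hlt | hlt
  · exact h i j hlt hi hj
  · exact h j i hlt hj hi

open Classical in
/-- The link that contains a given nonterminal, and its shapes. -/
noncomputable def linkOf (D : G.N) : Option ({A : List G.N // A ∈ G.big} × H.Assignment) :=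
  if h : ∃ i, D ∈ (r.link i).1 then some (r.link h.choose, r.2 h.choose) else none

theorem linkOf_eq {i : Fin (G.ruleRk r.1)} {D : G.N} (hi : D ∈ (r.link i).1) :
    r.linkOf D = some (r.link i, r.2 i) := by
  have h : ∃ i, D ∈ (r.link i).1 := ⟨i, hi⟩
  rw [linkOf, dif_pos h, r.link_unique h.choose_spec hi]

theorem linkOf_eq_some {D : G.N} {B : {A : List G.N // A ∈ G.big}} {τ : H.Assignment} :
    r.linkOf D = some (B, τ) ↔ ∃ i, D ∈ (r.link i).1 ∧ r.link i = B ∧ r.2 i = τ := by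
  constructor
  · intro h
    by_cases hD : ∃ i, D ∈ (r.link i).1
    · obtain ⟨i, hi⟩ := hD
      rw [r.linkOf_eq hi] at h
      simp only [Option.some.injEq, Prod.mk.injEq] at h
      exact ⟨i, hi, h⟩
    · simp [linkOf, hD] at h
  · rintro ⟨i, hi, rfl, rfl⟩
    exact r.linkOf_eq hi

theorem exists_link {D : G.N} (hD : D ∈ r.1.1.nonterminals) : ∃ i, D ∈ (r.link i).1 := by
  obtain ⟨B, hB, hDB⟩ := (G.links_cover _ r.1.2 D).1 hD
  obtain ⟨i, rfl⟩ := List.get_of_mem hB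
  exact ⟨i, hDB⟩

theorem mem_nonterminals {i : Fin (G.ruleRk r.1)} {D : G.N} (hD : D ∈ (r.link i).1) :
    D ∈ r.1.1.nonterminals :=
  (G.links_cover _ r.1.2 D).2 ⟨_, List.get_mem _ i, hD⟩

end TypedRule

/-- The word into which a symbol of `G` is expanded, given the links of the nonterminals. -/
noncomputable def expand
    (ℓ : G.N → Option ({A : List G.N // A ∈ G.big} × H.Assignment)) :
    (ω : G.N ⊕ T) → Word (H.Comp ⊕ T) (Fin (Sum.elim G.rkN rkT ω))
  | Sum.inl D => (ℓ D).elim (Word.interleave (fun _ => []) (H.someShape D).1) fun p =>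
      Word.interleave (fun j => [Sum.inl (p.1, p.2, D, Fin.ofNat (b + 1) j)]) (p.2 D).1
  | Sum.inr a => Sum.inl (Sum.inr a) :: (List.finRange (rkT a)).map Sum.inr

theorem expand_of_eq_some {ℓ : G.N → Option ({A : List G.N // A ∈ G.big} × H.Assignment)}
    {D : G.N} {B : {A : List G.N // A ∈ G.big}} {τ : H.Assignment} (h : ℓ D = some (B, τ)) :
    expand ℓ (Sum.inl D) =
      Word.interleave (fun j => [Sum.inl (B, τ, D, Fin.ofNat (b + 1) j)]) (τ D).1 := by
  simp [expand, h]

/-- Nonterminals outside all links expand to an arbitrary shape with empty strings, only because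
`ShapeSystem.exists_interleave` demands a shape for every `D`. -/
theorem exists_expand (ℓ : G.N → Option ({A : List G.N // A ∈ G.big} × H.Assignment))
    (D : G.N) : ∃ s ∈ H.shapes D, ∃ w, expand ℓ (Sum.inl D) = Word.interleave w s := by
  rcases h : ℓ D with _ | ⟨B, τ⟩
  · exact ⟨_, (H.someShape D).2, _, by simp only [expand, h, Option.elim]; rfl⟩
  · exact ⟨_, (τ D).2, _, expand_of_eq_some h⟩

theorem vars_expand (ℓ : G.N → Option ({A : List G.N // A ∈ G.big} × H.Assignment))
    (ω : G.N ⊕ T) : (expand ℓ ω).vars.Perm (List.finRange (Sum.elim G.rkN rkT ω)) := by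
  cases ω with
  | inl D =>
    obtain ⟨s, hs, w, hw⟩ := exists_expand ℓ D
    exact (List.Perm.of_eq ((congrArg Word.vars hw).trans (Word.vars_interleave w s))).trans
      (H.perm D s hs)
  | inr a => simp [expand]

namespace TypedRule

variable (r : H.TypedRule)

/-- The words of the right-hand side. -/
noncomputable def rhsWord (C : G.N) (hC : C ∈ r.1.1.lhs) :
    Word (H.Comp ⊕ T) (Fin (G.rkN C)) := (r.1.1.rhs C hC).word (expand r.linkOf)

theorem exists_rhsWord (C : G.N) (hC : C ∈ r.1.1.lhs) :
    ∃ s ∈ H.shapes C, ∃ w, r.rhsWord C hC = Word.interleave w s :=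
  H.exists_interleave _ r.1.2 C hC _ _ (exists_expand _) fun a => ⟨Sum.inr a, rfl⟩

/-- One pair serves all proofs `hC`, and nonterminals outside the left-hand side get a dummy, so
that shapes form total assignments. -/
theorem exists_shape (C : G.N) : ∃ p : H.shapes C × (ℕ → List (H.Comp ⊕ T)),
    ∀ hC, r.rhsWord C hC = Word.interleave p.2 p.1.1 := by
  by_cases hC : C ∈ r.1.1.lhs
  · obtain ⟨s, hs, w, h⟩ := r.exists_rhsWord C hC
    exact ⟨(⟨s, hs⟩, w), fun _ => h⟩
  · exact ⟨(H.someShape C, fun _ => []), fun h => absurd h hC⟩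

/-- The shapes of the right-hand side. -/
noncomputable def shape : H.Assignment := fun C => (r.exists_shape C).choose.1

/-- The words between the blocks of the shapes of the right-hand side. -/
noncomputable def piece (C : G.N) : ℕ → List (H.Comp ⊕ T) := (r.exists_shape C).choose.2

theorem rhsWord_eq (C : G.N) (hC : C ∈ r.1.1.lhs) :
    r.rhsWord C hC = Word.interleave (r.piece C) (r.shape C).1 :=
  (r.exists_shape C).choose_spec hC

end TypedRule

/-- The sequence of all components with given big nonterminal and shapes. -/
def bigOf (A : {A : List G.N // A ∈ G.big}) (τ : H.Assignment) : List H.Nt :=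
  A.1.flatMap fun C => (List.range ((τ C).1.length + 1)).map fun j =>
    Sum.inr (Sum.inr (A, τ, C, Fin.ofNat (b + 1) j))

/-- Reduction modulo `b + 1` never takes effect, since a shape has at most `b` blocks. -/
theorem val_ofNat {τ : H.Assignment} {C : G.N} {j : ℕ} (hj : j ≤ (τ C).1.length) :
    (Fin.ofNat (b + 1) j).val = j :=
  Nat.mod_eq_of_lt (Nat.lt_succ_of_le (hj.trans (H.length_le C _ (τ C).2)))

theorem mem_bigOf {A : {A : List G.N // A ∈ G.big}} {τ : H.Assignment} {c : H.Nt} :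
    c ∈ bigOf A τ ↔ ∃ C ∈ A.1, ∃ j : Fin (b + 1), j.val ≤ (τ C).1.length ∧
      c = Sum.inr (Sum.inr (A, τ, C, j)) := by
  simp only [bigOf, List.mem_flatMap, List.mem_map, List.mem_range]
  constructor
  · rintro ⟨C, hC, j, hj, rfl⟩
    exact ⟨C, hC, _, by rw [val_ofNat (Nat.le_of_lt_succ hj)]; lia, rfl⟩
  · rintro ⟨C, hC, j, hj, rfl⟩
    exact ⟨C, hC, j, by lia, by simp⟩

theorem bigOf_ne_nil (A : {A : List G.N // A ∈ G.big}) (τ : H.Assignment) : bigOf A τ ≠ [] := by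
  obtain ⟨C, hC⟩ := List.exists_mem_of_ne_nil _ (G.big_ne_nil _ A.2)
  exact List.ne_nil_of_mem (mem_bigOf.2 ⟨C, hC, 0, Nat.zero_le _, rfl⟩)

/-- A component records its big nonterminal and shapes, so different big nonterminals made of
components are disjoint even if those of `G` overlap. -/
theorem bigOf_inj {A A' : {A : List G.N // A ∈ G.big}} {τ τ' : H.Assignment} {c : H.Nt}
    (h : c ∈ bigOf A τ) (h' : c ∈ bigOf A' τ') : A = A' ∧ τ = τ' := by
  obtain ⟨C, -, j, -, rfl⟩ := mem_bigOf.1 h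
  obtain ⟨C', -, j', -, h₁⟩ := mem_bigOf.1 h'
  simp only [Sum.inr.injEq, Prod.mk.injEq] at h₁
  exact ⟨h₁.1, h₁.2.1⟩

theorem bigOf_injective {A A' : {A : List G.N // A ∈ G.big}} {τ τ' : H.Assignment}
    (h : bigOf A τ = bigOf A' τ') : A = A' ∧ τ = τ' := by
  obtain ⟨c, hc⟩ := List.exists_mem_of_ne_nil _ (bigOf_ne_nil A τ)
  exact bigOf_inj hc (h ▸ hc)

theorem nodup_range_components (A : {A : List G.N // A ∈ G.big}) (τ : H.Assignment) (C : G.N) :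
    ((List.range ((τ C).1.length + 1)).map fun j =>
      ((A, τ, C, Fin.ofNat (b + 1) j) : H.Comp)).Nodup := by
  refine List.Nodup.map_on (fun j hj j' hj' h => ?_) List.nodup_range
  rw [List.mem_range] at hj hj'
  simp only [Prod.mk.injEq, true_and] at h
  rw [← val_ofNat (Nat.le_of_lt_succ hj), h, val_ofNat (Nat.le_of_lt_succ hj')]

theorem nodup_bigOf (A : {A : List G.N // A ∈ G.big}) (τ : H.Assignment) :
    (bigOf A τ).Nodup := by
  refine List.nodup_flatMap.2 ⟨fun C _ => ?_, (G.big_nodup _ A.2).imp fun hne c hc hc' => ?_⟩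
  · simpa [Function.comp_def] using (nodup_range_components A τ C).map
      ((Sum.inr_injective (α := Unit)).comp
        (Sum.inr_injective (α := Fin (G.multiplicity * (b + 1)))))
  · obtain ⟨j, -, rfl⟩ := List.mem_map.1 hc
    obtain ⟨j', -, h⟩ := List.mem_map.1 hc'
    simp only [Sum.inr.injEq, Prod.mk.injEq, true_and] at h
    exact hne h.1.symm

theorem length_bigOf_le (A : {A : List G.N // A ∈ G.big}) (τ : H.Assignment) :
    (bigOf A τ).length ≤ G.multiplicity * (b + 1) := by
  have h (l : List G.N) : (l.flatMap fun C => (List.range ((τ C).1.length + 1)).map fun j =>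
      (Sum.inr (Sum.inr (A, τ, C, Fin.ofNat (b + 1) j)) : H.Nt)).length ≤
      l.length * (b + 1) := by
    induction l with
    | nil => simp
    | cons C l ih =>
      have := H.length_le C _ (τ C).2
      rw [List.flatMap_cons, List.length_append, List.length_cons, Nat.succ_mul]
      simp only [List.length_map, List.length_range]
      lia
  exact (h A.1).trans (Nat.mul_le_mul_right _ (Finset.le_sup (f := List.length) A.2))

end ShapeSystem

end MCFTG

theorem List.filterMap_flatMap_eq {α β γ : Type} (f : β → Option γ) (g : α → List β)
    (l : List α) : (l.flatMap g).filterMap f = l.flatMap fun a => (g a).filterMap f := by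
  induction l <;> simp_all

theorem List.attach_flatMap_val {α β : Type} (l : List α) (f : α → List β) :
    (l.attach.flatMap fun a => f a.1) = l.flatMap f := by
  conv_rhs => rw [← List.attach_map_subtype_val l, List.flatMap_map]

/-! ### Rules of the MCFG: occurrences of nonterminals, and injectivity. -/

namespace MCFTG.ShapeSystem

variable {T : Type} {rkT : T → ℕ} {G : MCFTG rkT} {b : ℕ} {H : G.ShapeSystem b}

/-- The components that occur in a list of letters. -/
def comps (l : List (H.Comp ⊕ T)) : List H.Comp := l.filterMap Sum.getLeft?

theorem mem_comps {l : List (H.Comp ⊕ T)} {y : H.Comp} : y ∈ comps l ↔ Sum.inl y ∈ l := by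
  simp [comps, Sum.getLeft?_eq_some_iff]

namespace TypedRule

variable (r : H.TypedRule)

/-- The word of letters that is the right-hand side for a given nonterminal of the MCFG. -/
noncomputable def rhsPiece : H.Nt → List (H.Comp ⊕ T)
  | Sum.inl _ => r.piece G.S 0
  | Sum.inr (Sum.inl _) => []
  | Sum.inr (Sum.inr y) => r.piece y.2.2.1 y.2.2.2

/-- The rule of the MCFG that is obtained from a rule of `G` and shapes for its links. If
`start` holds, then the left-hand side is the initial nonterminal. -/
noncomputable def rule (start : Bool) : MCRule H.ntRk (monadicRk T) where
  lhs := if start then [Sum.inl ()] else bigOf r.lhs r.shape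
  rhs c _ := H.wordTree (r.rhsPiece c) (H.endTree c)
  links := List.ofFn fun i => bigOf (r.link i) (r.2 i)

/-- The condition under which `rule r start` is a rule of the MCFG. -/
def Allowed : Bool → Prop
  | true => r.1.1.lhs = [G.S]
  | false => ¬ (G.StartSeparated ∧ r.1.1.lhs = [G.S])

variable {r} {start : Bool}

theorem nonterminals_rule : (r.rule start).nonterminals =
    ((r.rule start).lhs.flatMap fun c => comps (r.rhsPiece c)).map (Sum.inr ∘ Sum.inr) := by
  rw [MCRule.nonterminals, List.filterMap_flatMap_eq,
    ← List.attach_flatMap_val _ fun c => comps (r.rhsPiece c), List.map_flatMap]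
  refine List.flatMap_congr fun c _ => ?_
  simp only [rule, symbols_wordTree, List.filterMap_append, letters_endTree, List.append_nil,
    comps, List.filterMap_map, List.map_filterMap]
  refine List.filterMap_congr fun z _ => ?_
  cases z <;> rfl

/-- The shape of the initial nonterminal is empty. -/
theorem shape_start : (r.shape G.S).1 = [] := H.nil_of_start _ (r.shape G.S).2

theorem flatMap_bigOf {α : Type} (f : List (H.Comp ⊕ T) → List α) :
    ((bigOf r.lhs r.shape).flatMap fun c => f (r.rhsPiece c)) =
      r.1.1.lhs.flatMap fun C =>
        (List.range ((r.shape C).1.length + 1)).flatMap fun j => f (r.piece C j) := by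
  rw [bigOf, List.flatMap_assoc]
  congr 1
  funext C
  rw [List.flatMap_map]
  refine List.flatMap_congr fun j hj => ?_
  simp only [rhsPiece]
  rw [val_ofNat (Nat.le_of_lt_succ (List.mem_range.1 hj))]

/-- Both kinds of left-hand side are treated alike: the empty shape of `G.S` leaves only piece 0,
which `rhsPiece` assigns to the new initial nonterminal. -/
theorem flatMap_lhs {α : Type} (h : r.Allowed start) (f : List (H.Comp ⊕ T) → List α) :
    ((r.rule start).lhs.flatMap fun c => f (r.rhsPiece c)) =
      r.1.1.lhs.flatMap fun C =>
        (List.range ((r.shape C).1.length + 1)).flatMap fun j => f (r.piece C j) := by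
  cases start with
  | false => exact flatMap_bigOf f
  | true =>
    have h : r.1.1.lhs = [G.S] := h
    rw [h]
    simp [rule, rhsPiece, shape_start]

/-- The components that replace a nonterminal of the right-hand side. -/
noncomputable def compsOf (r : H.TypedRule) (D : G.N) : List H.Comp :=
  (r.linkOf D).elim [] fun p =>
    (List.range ((p.2 D).1.length + 1)).map fun j => (p.1, p.2, D, Fin.ofNat (b + 1) j)

theorem comps_expand (D : G.N) :
    comps (expand r.linkOf (Sum.inl D)).letters = r.compsOf D := by
  rcases h : r.linkOf D with _ | ⟨B, τ⟩
  · have : comps (Word.letters (Word.interleave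
        (fun _ => ([] : List (H.Comp ⊕ T))) (H.someShape D).1)) = [] := by
      rw [Word.letters_interleave]; simp [comps]
    simpa [expand, h, compsOf] using this
  · have : comps (Word.letters (Word.interleave
        (fun j => [Sum.inl ((B, τ, D, Fin.ofNat (b + 1) j) : H.Comp)]) (τ D).1)) =
        r.compsOf D := by
      rw [Word.letters_interleave, comps, List.filterMap_flatMap_eq]
      simp only [compsOf, h, Option.elim]
      exact List.map_eq_flatMap.symm
    rw [expand_of_eq_some h]
    exact this

theorem mem_compsOf {D : G.N} {y : H.Comp} : y ∈ r.compsOf D ↔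
    ∃ i, D ∈ (r.link i).1 ∧ ∃ j : Fin (b + 1), j.val ≤ (r.2 i D).1.length ∧
      y = (r.link i, r.2 i, D, j) := by
  rcases h : r.linkOf D with _ | ⟨B, τ⟩
  · simp only [compsOf, h, Option.elim, List.not_mem_nil, false_iff, not_exists, not_and]
    intro i hi
    simp [r.linkOf_eq hi] at h
  · have h' := h
    obtain ⟨i, hi, rfl, rfl⟩ := r.linkOf_eq_some.1 h
    simp only [compsOf, h', Option.elim, List.mem_map, List.mem_range]
    constructor
    · rintro ⟨j, hj, rfl⟩
      exact ⟨i, hi, _, by rw [val_ofNat (Nat.le_of_lt_succ hj)]; lia, rfl⟩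
    · rintro ⟨k, hk, j, hj, rfl⟩
      obtain rfl := r.link_unique hi hk
      exact ⟨j, by lia, by simp⟩

/-- Cutting words into pieces keeps every letter, and by `RTree.letters_word` each occurrence of `D`
contributes its components once. Uniqueness and covering by links are thereby inherited from `G`. -/
theorem flatMap_comps_perm (h : r.Allowed start) :
    ((r.rule start).lhs.flatMap fun c => comps (r.rhsPiece c)).Perm
      (r.1.1.nonterminals.flatMap r.compsOf) := by
  rw [flatMap_lhs h, MCRule.nonterminals, ← List.attach_flatMap_val, List.filterMap_flatMap_eq,
    List.flatMap_assoc]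
  refine List.Perm.flatMap_left _ fun C _ => ?_
  have h₁ : ((List.range ((r.shape C.1).1.length + 1)).flatMap fun j =>
      comps (r.piece C.1 j)) = comps (r.rhsWord C.1 C.2).letters := by
    rw [r.rhsWord_eq, Word.letters_interleave, comps, List.filterMap_flatMap_eq]
    rfl
  have h₂ : ((r.1.1.rhs C.1 C.2).symbols.filterMap Sum.getLeft?).flatMap r.compsOf =
      comps ((r.1.1.rhs C.1 C.2).symbols.flatMap fun ω => (expand r.linkOf ω).letters) := by
    induction (r.1.1.rhs C.1 C.2).symbols with
    | nil => rfl
    | cons ω l ih =>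
      cases ω with
      | inl D =>
        have := comps_expand (r := r) D
        simp only [comps] at this ih
        simp [comps, ih, ← this]
      | inr a =>
        have : comps (expand r.linkOf (Sum.inr a)).letters = [] := by simp [expand, comps]
        rw [List.flatMap_cons, comps, List.filterMap_append]
        exact ih.trans (congrArg (· ++ _) this.symm)
  rw [h₁, h₂]
  exact (RTree.letters_word (vars_expand r.linkOf) _).filterMap _

theorem mem_nonterminals_rule (h : r.Allowed start) {c : H.Nt} :
    c ∈ (r.rule start).nonterminals ↔ ∃ i, c ∈ bigOf (r.link i) (r.2 i) := by
  rw [nonterminals_rule, ((flatMap_comps_perm h).map _).mem_iff]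
  simp only [List.mem_map, List.mem_flatMap, mem_compsOf, mem_bigOf]
  constructor
  · rintro ⟨y, ⟨D, -, i, hi, j, hj, rfl⟩, rfl⟩
    exact ⟨i, D, hi, j, hj, rfl⟩
  · rintro ⟨i, D, hi, j, hj, rfl⟩
    exact ⟨_, ⟨D, r.mem_nonterminals hi, i, hi, j, hj, rfl⟩, rfl⟩

theorem nodup_nonterminals_rule (h : r.Allowed start) : (r.rule start).nonterminals.Nodup := by
  rw [nonterminals_rule, ((flatMap_comps_perm h).map _).nodup_iff]
  refine List.Nodup.map (Sum.inr_injective.comp Sum.inr_injective) ?_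
  refine List.nodup_flatMap.2 ⟨fun D _ => ?_, (G.rhs_unique _ r.1.2).imp fun hne y hy hy' => ?_⟩
  · rcases h : r.linkOf D with _ | ⟨B, τ⟩
    · simp [compsOf, h]
    · simp only [compsOf, h, Option.elim]
      exact nodup_range_components B τ D
  · obtain ⟨i, -, j, -, rfl⟩ := mem_compsOf.1 hy
    obtain ⟨i', -, j', -, h⟩ := mem_compsOf.1 hy'
    simp only [Prod.mk.injEq] at h
    exact hne h.2.2.1

theorem pairwise_disjoint_links (r : H.TypedRule) (start : Bool) :
    (r.rule start).links.Pairwise List.Disjoint := by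
  refine List.pairwise_ofFn.2 fun i j hij c hc hc' => ?_
  obtain ⟨D, hD, k, -, rfl⟩ := mem_bigOf.1 hc
  obtain ⟨D', hD', k', -, h⟩ := mem_bigOf.1 hc'
  simp only [Sum.inr.injEq, Prod.mk.injEq] at h
  obtain ⟨-, -, rfl, -⟩ := h
  exact hij.ne (r.link_unique hD hD')

/-- Shapes and words of the right-hand side are determined by the rule of the MCFG. -/
theorem rule_lhs_rhs_inj {r r' : H.TypedRule} {start start' : Bool} (h : r.Allowed start)
    (h' : r'.Allowed start') (hlhs : (r.rule start).lhs = (r'.rule start').lhs)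
    (hrhs : ∀ c hc hc', (r.rule start).rhs c hc = (r'.rule start').rhs c hc') :
    start = start' ∧ r.lhs = r'.lhs ∧
      ∀ C hC hC', r.rhsWord C hC = r'.rhsWord C hC' := by
  have key (C : G.N) (hs : (r.shape C).1 = (r'.shape C).1)
      (hp : ∀ j ≤ (r.shape C).1.length, r.piece C j = r'.piece C j) (hC hC') :
      r.rhsWord C hC = r'.rhsWord C hC' := by
    rw [r.rhsWord_eq, r'.rhsWord_eq, ← hs]
    exact Word.interleave_congr hp
  have hpiece (c) (hc : c ∈ (r.rule start).lhs) : r.rhsPiece c = r'.rhsPiece c :=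
    H.wordTree_injective (hrhs c hc (hlhs ▸ hc))
  have hne {A : {A : List G.N // A ∈ G.big}} {τ : H.Assignment} :
      [(Sum.inl () : H.Nt)] ≠ bigOf A τ := fun hAτ => by
    obtain ⟨C, -, j, -, h⟩ := mem_bigOf.1 (hAτ ▸ List.mem_singleton_self _)
    cases h
  cases start <;> cases start'
  · obtain ⟨h₁, h₂⟩ := bigOf_injective hlhs
    refine ⟨rfl, h₁, fun C hC hC' => key C (by rw [h₂]) (fun j hj => ?_) hC hC'⟩
    have hj' := val_ofNat hj
    have := hpiece (Sum.inr (Sum.inr (r.lhs, r.shape, C, Fin.ofNat (b + 1) j)))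
      (mem_bigOf.2 ⟨C, hC, _, hj'.le.trans hj, rfl⟩)
    simpa only [rhsPiece, hj'] using this
  · exact absurd hlhs.symm hne
  · exact absurd hlhs hne
  · have h₁ : r.1.1.lhs = [G.S] := h
    have h₂ : r'.1.1.lhs = [G.S] := h'
    refine ⟨rfl, Subtype.ext (h₁.trans h₂.symm), fun C hC hC' => ?_⟩
    obtain rfl : C = G.S := by simpa [h₁] using hC
    refine key _ (by rw [shape_start, shape_start]) (fun j hj => ?_) hC hC'
    rw [shape_start, List.length_nil, Nat.le_zero] at hj
    subst hj
    exact hpiece (Sum.inl ()) (List.mem_singleton_self _)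

theorem exists_link_of_perm {r r' : H.TypedRule} {start start' : Bool}
    (h : (r.rule start).links.Perm (r'.rule start').links) (i) :
    ∃ i', r'.link i' = r.link i ∧ r'.2 i' = r.2 i := by
  obtain ⟨i', hi'⟩ := List.mem_ofFn.1 (h.mem_iff.1 (List.mem_ofFn.2 ⟨i, rfl⟩))
  exact ⟨i', bigOf_injective hi'⟩

/-- The links of the MCFG rule still reveal big nonterminals and shapes, and `linkOf` does not
depend on their order. -/
theorem linkOf_eq_of_perm {r r' : H.TypedRule} {start start' : Bool}
    (h : (r.rule start).links.Perm (r'.rule start').links) : r.linkOf = r'.linkOf := by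
  funext D
  refine Option.ext fun ⟨B, τ⟩ => ?_
  rw [linkOf_eq_some, linkOf_eq_some]
  constructor
  · rintro ⟨i, hi, rfl, rfl⟩
    obtain ⟨i', h₁, h₂⟩ := exists_link_of_perm h i
    exact ⟨i', h₁ ▸ hi, h₁, h₂⟩
  · rintro ⟨i, hi, rfl, rfl⟩
    obtain ⟨i', h₁, h₂⟩ := exists_link_of_perm h.symm i
    exact ⟨i', h₁ ▸ hi, h₁, h₂⟩

open Classical in
/-- The big nonterminal of `G` from which a big nonterminal of the MCFG is made. -/
noncomputable def untype (B : List H.Nt) : List G.N :=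
  if h : ∃ A τ, B = bigOf A τ then h.choose.1 else []

theorem untype_bigOf (A : {A : List G.N // A ∈ G.big}) (τ : H.Assignment) :
    untype (bigOf A τ) = A.1 := by
  have h : ∃ A' τ', bigOf A τ = bigOf A' τ' := ⟨A, τ, rfl⟩
  rw [untype, dif_pos h, ← (bigOf_injective h.choose_spec.choose_spec).1]

theorem map_untype_links (r : H.TypedRule) (start : Bool) :
    (r.rule start).links.map untype = r.1.1.links := by
  rw [rule, List.map_ofFn]
  simp only [Function.comp_def, untype_bigOf]
  exact List.ofFn_get r.1.1.links

/-- This gives `rules_ext` for the MCFG. The links determine how each symbol is expanded; by unique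
readability the words of the right-hand side then determine its trees, and `rules_ext` of `G`
identifies the underlying rules. The link shapes agree index by index because links are nonempty and
disjoint. -/
theorem rule_inj {r r' : H.TypedRule} {start start' : Bool} (h : r.Allowed start)
    (h' : r'.Allowed start') (hlhs : (r.rule start).lhs = (r'.rule start').lhs)
    (hrhs : ∀ c hc hc', (r.rule start).rhs c hc = (r'.rule start').rhs c hc')
    (hlinks : (r.rule start).links.Perm (r'.rule start').links) : r = r' ∧ start = start' := by
  obtain ⟨hs, hA, hw⟩ := rule_lhs_rhs_inj h h' hlhs hrhs
  refine ⟨?_, hs⟩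
  have hℓ := linkOf_eq_of_perm hlinks
  have hmem (r : H.TypedRule) (C hC D) (hD : Sum.inl D ∈ (r.1.1.rhs C hC).symbols) :
      D ∈ r.1.1.nonterminals := List.mem_filterMap.2
    ⟨_, List.mem_flatMap.2 ⟨⟨C, hC⟩, List.mem_attach _ _, hD⟩, rfl⟩
  have hrule : r.1 = r'.1 := by
    refine Subtype.ext (G.rules_ext _ r.1.2 _ r'.1.2 (congrArg Subtype.val hA) ?_ ?_)
    · intro C hC hC'
      have hword := hw C hC hC'
      rw [rhsWord, rhsWord, ← hℓ] at hword
      -- Component 0 precedes the first block, so it is the first letter for every shape.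
      have hx (D' : G.N) (p : {A : List G.N // A ∈ G.big} × H.Assignment)
          (hD' : r.linkOf D' = some p) : ∃ l, expand r.linkOf (Sum.inl D') =
            Sum.inl (Sum.inl (p.1, p.2, D', Fin.ofNat (b + 1) 0)) :: l := by
        rw [expand_of_eq_some hD']
        cases (p.2 D').1 <;> exact ⟨_, rfl⟩
      -- Unlinked nonterminals expand to words without letters, so `p` keeps only terminals and
      -- linked nonterminals; no others occur.
      refine (RTree.word_append_inj (r := []) (r' := [])
        (p := fun ω => ∀ D, ω = Sum.inl D → r.linkOf D ≠ none)
        (vars_expand r.linkOf) ?_ ?_ ?_ (by simpa using hword)).1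
      · rintro (D | a) hω
        · obtain ⟨⟨B, τ⟩, hD⟩ := Option.ne_none_iff_exists'.1 (hω D rfl)
          obtain ⟨l, hl⟩ := hx D _ hD
          refine ⟨_, l, hl, ?_⟩
          rintro (D' | a) l' hω' hl'
          · obtain ⟨p', hp'⟩ := Option.ne_none_iff_exists'.1 (hω' D' rfl)
            obtain ⟨l'', hl''⟩ := hx D' p' hp'
            rw [hl''] at hl'
            simp only [List.cons.injEq, Sum.inl.injEq, Prod.mk.injEq] at hl'
            rw [hl'.1.2.2.1]
          · exact absurd (Sum.inl_injective (List.cons.inj hl').1) Sum.inr_ne_inl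
        · refine ⟨Sum.inr a, _, rfl, ?_⟩
          rintro (D' | a') l' hω' hl'
          · obtain ⟨p', hp'⟩ := Option.ne_none_iff_exists'.1 (hω' D' rfl)
            obtain ⟨l'', hl''⟩ := hx D' p' hp'
            rw [hl''] at hl'
            exact absurd (Sum.inl_injective (List.cons.inj hl').1) Sum.inl_ne_inr
          · simp only [expand, List.cons.injEq, Sum.inl.injEq, Sum.inr.injEq] at hl'
            rw [hl'.1]
      · rintro _ hD D rfl
        obtain ⟨i, hi⟩ := r.exists_link (hmem r C hC D hD)
        simp [r.linkOf_eq hi]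
      · rintro _ hD D rfl
        obtain ⟨i, hi⟩ := r'.exists_link (hmem r' C hC' D hD)
        simp [hℓ, r'.linkOf_eq hi]
    · rw [← map_untype_links r start, ← map_untype_links r' start']
      exact hlinks.map _
  obtain ⟨ρ, σ⟩ := r
  obtain ⟨ρ', σ'⟩ := r'
  obtain rfl : ρ = ρ' := hrule
  congr 1
  funext i
  obtain ⟨i', h₁, h₂⟩ := exists_link_of_perm hlinks i
  obtain ⟨D, hD⟩ := List.exists_mem_of_ne_nil _ (G.big_ne_nil _ (link ⟨ρ, σ⟩ i).2)
  have : i' = i := link_unique ⟨ρ, σ⟩ (D := D) (by rw [← h₁] at hD; exact hD) hD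
  subst this
  exact h₂.symm

end TypedRule

end MCFTG.ShapeSystem

/-! ### The value of a derivation tree, one level at a time. -/

namespace MCFTG

section Val

variable {T : Type} {rkT : T → ℕ} (G : MCFTG rkT)

open Classical in
/-- The second-order substitution that is used in the definition of the value. -/
noncomputable def valSubst (ρ : G.RuleSym) (ds : Fin (G.ruleRk ρ) → RTree G.ruleRk Empty) :
    (ω : G.N ⊕ T) → RTree (Sum.elim G.rkN rkT) (Fin (Sum.elim G.rkN rkT ω))
  | Sum.inl D =>
      if hD : ∃ i : Fin ρ.1.links.length, D ∈ ρ.1.links.get i then G.val (ds hD.choose) D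
      else RTree.init (rk := Sum.elim G.rkN rkT) (Sum.inl D)
  | Sum.inr a => RTree.init (rk := Sum.elim G.rkN rkT) (Sum.inr a)

theorem val_node {ρ : G.RuleSym} (ds : Fin (G.ruleRk ρ) → RTree G.ruleRk Empty) {C : G.N}
    (hC : C ∈ ρ.1.lhs) :
    G.val (.node ρ ds) C = (ρ.1.rhs C hC).hom (G.valSubst ρ ds) := by
  rw [val]
  refine (dif_pos hC).trans (congrArg (fun h => RTree.hom h _) (funext fun ω => ?_))
  cases ω <;> rfl

theorem valSubst_inl {ρ : G.RuleSym} (ds : Fin (G.ruleRk ρ) → RTree G.ruleRk Empty) {D : G.N}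
    {i : Fin ρ.1.links.length} (hD : D ∈ ρ.1.links.get i) :
    G.valSubst ρ ds (Sum.inl D) = G.val (ds i) D := by
  have h : ∃ i : Fin ρ.1.links.length, D ∈ ρ.1.links.get i := ⟨i, hD⟩
  have hi : h.choose = i := by
    by_contra hne
    have hp := List.pairwise_iff_get.1 (G.links_disjoint _ ρ.2)
    rcases lt_or_gt_of_ne hne with hlt | hlt
    · exact hp _ _ hlt h.choose_spec hD
    · exact hp _ _ hlt hD h.choose_spec
  exact (dif_pos h).trans (congrArg (fun i => G.val (ds i) D) hi)

end Val

/-! ### The MCFG and its parameters. -/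

namespace ShapeSystem

variable {T : Type} {rkT : T → ℕ} {G : MCFTG rkT} {b : ℕ} (H : G.ShapeSystem b)

/-- The big nonterminal without rules. -/
def idle : List H.Nt := (List.finRange (G.multiplicity * (b + 1))).map (Sum.inr ∘ Sum.inl)

theorem one_le_multiplicity (G : MCFTG rkT) : 1 ≤ G.multiplicity :=
  Finset.le_sup (f := List.length) G.S_big

theorem length_idle : H.idle.length = G.multiplicity * (b + 1) := by simp [idle]

theorem mem_idle {c : H.Nt} : c ∈ H.idle ↔ ∃ i, c = Sum.inr (Sum.inl i) := by
  simp [idle, eq_comm]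

theorem finite_big : {B : List H.Nt | B = [Sum.inl ()] ∨ B = H.idle ∨
    ∃ A τ, B = bigOf A τ}.Finite := by
  refine (Set.finite_singleton _).union ((Set.finite_singleton _).union ?_)
  refine (Set.finite_range fun p : {A : List G.N // A ∈ G.big} × H.Assignment =>
    bigOf p.1 p.2).subset ?_
  rintro _ ⟨A, τ, rfl⟩
  exact ⟨(A, τ), rfl⟩

theorem finite_rules : {ρ' : MCRule H.ntRk (monadicRk T) |
    ∃ (r : H.TypedRule) (start : Bool), r.Allowed start ∧ ρ' = r.rule start}.Finite := by
  refine (Set.finite_range fun p : H.TypedRule × Bool => p.1.rule p.2).subset ?_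
  rintro _ ⟨r, start, -, rfl⟩
  exact ⟨(r, start), rfl⟩

/-- The MCFG that is constructed from a shape system. -/
noncomputable def grammar : MCFTG (monadicRk T) where
  finite_T := by
    have := G.finite_T
    infer_instance
  exists_rank_pos := G.exists_rank_pos.imp' some fun _ _ => le_rfl
  N := H.Nt
  fintype_N := Fintype.ofFinite _
  rkN := H.ntRk
  big := H.finite_big.toFinset
  big_ne_nil A hA := by
    rcases (Set.Finite.mem_toFinset _).1 hA with rfl | rfl | ⟨A, τ, rfl⟩
    · simp
    · have := one_le_multiplicity G
      have h : 0 < G.multiplicity * (b + 1) := by positivity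
      exact List.ne_nil_of_mem (H.mem_idle.2 ⟨⟨0, h⟩, rfl⟩)
    · exact bigOf_ne_nil A τ
  big_nodup A hA := by
    rcases (Set.Finite.mem_toFinset _).1 hA with rfl | rfl | ⟨A, τ, rfl⟩
    · simp
    · exact (List.nodup_finRange _).map (Sum.inr_injective.comp Sum.inl_injective)
    · exact nodup_bigOf A τ
  big_inj A hA A' hA' h := by
    have h₁ {B τ} : ∃ c, c ∈ bigOf (H := H) B τ := List.exists_mem_of_ne_nil _ (bigOf_ne_nil B τ)
    have h₂ {B τ} {c : H.Nt} (hc : c ∈ bigOf B τ) : ∃ y, c = Sum.inr (Sum.inr y) := by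
      obtain ⟨C, -, j, -, rfl⟩ := mem_bigOf.1 hc
      exact ⟨_, rfl⟩
    rcases (Set.Finite.mem_toFinset _).1 hA with rfl | rfl | ⟨B, τ, rfl⟩ <;>
    rcases (Set.Finite.mem_toFinset _).1 hA' with rfl | rfl | ⟨B', τ', rfl⟩
    · rfl
    · simpa [mem_idle] using h (Sum.inl ())
    · obtain ⟨y, hy⟩ := h₂ ((h (Sum.inl ())).1 (List.mem_singleton_self _))
      cases hy
    · simpa [mem_idle] using h (Sum.inl ())
    · rfl
    · obtain ⟨c, hc⟩ := h₁ (B := B') (τ := τ')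
      obtain ⟨y, rfl⟩ := h₂ hc
      simpa [mem_idle] using (h _).2 hc
    · obtain ⟨y, hy⟩ := h₂ ((h (Sum.inl ())).2 (List.mem_singleton_self _))
      cases hy
    · obtain ⟨c, hc⟩ := h₁ (B := B) (τ := τ)
      obtain ⟨y, rfl⟩ := h₂ hc
      simpa [mem_idle] using (h _).1 hc
    · obtain ⟨c, hc⟩ := h₁ (B := B) (τ := τ)
      obtain ⟨rfl, rfl⟩ := bigOf_inj hc ((h c).1 hc)
      rfl
  S := Sum.inl ()
  S_big := (Set.Finite.mem_toFinset _).2 (Or.inl rfl)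
  S_rank := rfl
  rules := H.finite_rules.toFinset
  lhs_big ρ' hρ' := by
    obtain ⟨r, start, -, rfl⟩ := (Set.Finite.mem_toFinset _).1 hρ'
    refine (Set.Finite.mem_toFinset _).2 ?_
    cases start
    · exact Or.inr (Or.inr ⟨_, _, rfl⟩)
    · exact Or.inl rfl
  rhs_pattern ρ' hρ' c hc := by
    obtain ⟨r, start, -, rfl⟩ := (Set.Finite.mem_toFinset _).1 hρ'
    exact H.isPattern_wordTree _ _
  rhs_unique ρ' hρ' := by
    obtain ⟨r, start, h, rfl⟩ := (Set.Finite.mem_toFinset _).1 hρ'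
    exact TypedRule.nodup_nonterminals_rule h
  links_big ρ' hρ' B hB := by
    obtain ⟨r, start, -, rfl⟩ := (Set.Finite.mem_toFinset _).1 hρ'
    obtain ⟨i, rfl⟩ := List.mem_ofFn.1 hB
    exact (Set.Finite.mem_toFinset _).2 (Or.inr (Or.inr ⟨_, _, rfl⟩))
  links_disjoint ρ' hρ' := by
    obtain ⟨r, start, -, rfl⟩ := (Set.Finite.mem_toFinset _).1 hρ'
    exact TypedRule.pairwise_disjoint_links r start
  links_cover ρ' hρ' c := by
    obtain ⟨r, start, h, rfl⟩ := (Set.Finite.mem_toFinset _).1 hρ'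
    rw [TypedRule.mem_nonterminals_rule h]
    simp [TypedRule.rule, List.mem_ofFn]
  rules_ext ρ' hρ' ρ'' hρ'' h₁ h₂ h₃ := by
    obtain ⟨r, start, h, rfl⟩ := (Set.Finite.mem_toFinset _).1 hρ'
    obtain ⟨r', start', h', rfl⟩ := (Set.Finite.mem_toFinset _).1 hρ''
    obtain ⟨rfl, rfl⟩ := TypedRule.rule_inj h h' h₁ h₂ h₃
    rfl

theorem mem_grammar_rules {ρ' : MCRule H.ntRk (monadicRk T)} : ρ' ∈ H.grammar.rules ↔
    ∃ (r : H.TypedRule) (start : Bool), r.Allowed start ∧ ρ' = r.rule start :=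
  Set.Finite.mem_toFinset _

theorem mem_grammar_big {B : List H.Nt} : B ∈ H.grammar.big ↔
    B = [Sum.inl ()] ∨ B = H.idle ∨ ∃ A τ, B = bigOf A τ :=
  Set.Finite.mem_toFinset _

theorem isMCFG_grammar : H.grammar.IsMCFG := by
  refine ⟨fun c hc => ?_, fun B hB hS => ?_, fun ρ' hρ' hS => ?_⟩
  · rcases c with u | c
    · exact absurd rfl hc
    · rfl
  · rcases H.mem_grammar_big.1 hB with rfl | rfl | ⟨A, τ, rfl⟩
    · rfl
    · obtain ⟨i, hi⟩ := H.mem_idle.1 hS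
      cases hi
    · obtain ⟨C, -, j, -, h⟩ := mem_bigOf.1 hS
      cases h
  · obtain ⟨r, start, h, rfl⟩ := H.mem_grammar_rules.1 hρ'
    obtain ⟨i, hi⟩ := (TypedRule.mem_nonterminals_rule h).1 hS
    obtain ⟨C, -, j, -, h⟩ := mem_bigOf.1 hi
    cases h

/-- Sequences of components can be too short, as shapes may have fewer than `b` blocks; `idle`
attains the bound. -/
theorem multiplicity_grammar : H.grammar.multiplicity = G.multiplicity * (b + 1) := by
  apply le_antisymm
  · refine Finset.sup_le fun B hB => ?_
    rcases H.mem_grammar_big.1 hB with rfl | rfl | ⟨A, τ, rfl⟩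
    · exact Nat.mul_pos (one_le_multiplicity G) b.succ_pos
    · exact H.length_idle.le
    · exact length_bigOf_le A τ
  · exact H.length_idle.ge.trans
      (Finset.le_sup (f := List.length) (H.mem_grammar_big.2 (Or.inr (Or.inl rfl))))

theorem length_links_rule (r : H.TypedRule) (start : Bool) :
    (r.rule start).links.length = G.ruleRk r.1 := List.length_ofFn

theorem ruleWidth_grammar : H.grammar.ruleWidth = G.ruleWidth := by
  apply le_antisymm
  · refine Finset.sup_le fun ρ' hρ' => ?_
    obtain ⟨r, start, -, rfl⟩ := H.mem_grammar_rules.1 hρ'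
    exact (H.length_links_rule r start).le.trans
      (Finset.le_sup (f := fun ρ : MCRule G.rkN rkT => ρ.links.length) r.1.2)
  · refine Finset.sup_le fun ρ hρ => ?_
    let r : H.TypedRule := ⟨⟨ρ, hρ⟩, fun _ => H.someShape⟩
    -- Every rule survives in at least one copy: the initial one for `[G.S]`, the ordinary one
    -- otherwise.
    have h : ∃ start, r.Allowed start := by
      by_cases h : ρ.lhs = [G.S]
      · exact ⟨true, h⟩
      · exact ⟨false, fun h' => h h'.2⟩
    obtain ⟨start, h⟩ := h
    exact (H.length_links_rule r start).ge.trans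
      (Finset.le_sup (f := fun ρ : MCRule H.grammar.rkN (monadicRk T) => ρ.links.length)
        (H.mem_grammar_rules.2 ⟨r, start, h, rfl⟩))

/-- Every terminal of a right-hand side lands in some piece. The only danger is the ordinary copy of
a rule S → (u, ∅), which would be proper although the original is not; `Allowed` drops it because
`G` is start-separated. -/
theorem isLexicalized_grammar (hG : G.StartSeparated) {Δ : Set T} (hΔ : G.IsLexicalized Δ) :
    H.grammar.IsLexicalized (some '' Δ) := by
  intro ρ' hρ' hproper
  obtain ⟨r, start, h, rfl⟩ := H.mem_grammar_rules.1 hρ'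
  have hr : G.IsProper r.1.1 := by
    rintro ⟨h₁, h₂⟩
    cases start with
    | false => exact h ⟨hG, h₁⟩
    | true =>
      refine hproper ⟨rfl, List.eq_nil_of_length_eq_zero ?_⟩
      exact (H.length_links_rule r true).trans (by rw [ruleRk, h₂, List.length_nil])
  obtain ⟨C, hC, a, ha, hmem⟩ := hΔ _ r.1.2 hr
  have h₁ : Sum.inr a ∈ (r.rhsWord C hC).letters := by
    refine ((RTree.letters_word (vars_expand r.linkOf) _).mem_iff).2
      (List.mem_flatMap.2 ⟨_, hmem, ?_⟩)
    simp [expand]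
  have h₂ : Sum.inr a ∈ (r.rule start).lhs.flatMap fun c => id (r.rhsPiece c) := by
    rw [TypedRule.flatMap_lhs h]
    rw [r.rhsWord_eq, Word.letters_interleave] at h₁
    exact List.mem_flatMap.2 ⟨C, hC, h₁⟩
  obtain ⟨c, hc, hac⟩ := List.mem_flatMap.1 h₂
  refine ⟨c, hc, some a, ⟨a, ha, rfl⟩, ?_⟩
  change Sum.inr (some a) ∈ (H.wordTree (r.rhsPiece c) (H.endTree c)).symbols
  rw [symbols_wordTree]
  exact List.mem_append_left _ (List.mem_map.2 ⟨_, hac, rfl⟩)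

/-! ### Values of derivation trees -/

variable {H}

theorem wordTree_append {V : Type} (w w' : List (H.Comp ⊕ T)) (t : H.MTree V) :
    H.wordTree (w ++ w') t = H.wordTree w (H.wordTree w' t) := by
  induction w with
  | nil => rfl
  | cons z w ih => cases z <;> simp [wordTree, ih]

theorem bind_wordTree {V W : Type} (w : List (H.Comp ⊕ T)) (t : H.MTree V)
    (f : V → H.MTree W) : (H.wordTree w t).bind f = H.wordTree w (t.bind f) := by
  induction w with
  | nil => rfl
  | cons z w ih => cases z <;> simp [wordTree, RTree.bind, ih]

/-- On monadic trees, plugging into the variable is concatenation, so second-order substitution acts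
as the string homomorphism `θ`. -/
theorem hom_wordTree {V : Type} (w : List (H.Comp ⊕ T)) (t : H.MTree V)
    (h : (ω : H.Nt ⊕ Option T) → H.MTree (Fin (Sum.elim H.ntRk (monadicRk T) ω)))
    (θ : H.Comp ⊕ T → List T)
    (h₁ : ∀ y, Sum.inl y ∈ w → h (Sum.inl (Sum.inr (Sum.inr y))) =
      H.wordTree ((θ (Sum.inl y)).map Sum.inr) (H.endTree (Sum.inr (Sum.inr y))))
    (h₂ : ∀ a, h (Sum.inr a) = RTree.init (rk := Sum.elim H.ntRk (monadicRk T)) (Sum.inr a))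
    (h₃ : ∀ a, θ (Sum.inr a) = [a]) :
    (H.wordTree w t).hom h = H.wordTree ((w.flatMap θ).map Sum.inr) (t.hom h) := by
  induction w with
  | nil => rfl
  | cons z w ih =>
    have ih := ih fun y hy => h₁ y (List.mem_cons_of_mem _ hy)
    cases z with
    | inl y =>
      rw [wordTree, RTree.hom, h₁ y List.mem_cons_self]
      refine (bind_wordTree _ _ _).trans ?_
      rw [List.flatMap_cons, List.map_append, wordTree_append]
      exact congrArg _ ih
    | inr a =>
      rw [wordTree, RTree.hom, h₂, ih, List.flatMap_cons, h₃]
      rfl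

theorem hom_endTree (c : H.Nt)
    (h : (ω : H.Nt ⊕ Option T) → H.MTree (Fin (Sum.elim H.ntRk (monadicRk T) ω)))
    (h₂ : ∀ a, h (Sum.inr a) = RTree.init (rk := Sum.elim H.ntRk (monadicRk T)) (Sum.inr a)) :
    (H.endTree c).hom h = H.endTree c := by
  cases c with
  | inl u =>
    refine (congrArg (RTree.bind fun i => RTree.hom h (Fin.elim0 i)) (h₂ none)).trans ?_
    exact congrArg (RTree.node (rk := Sum.elim H.ntRk (monadicRk T)) (Sum.inr none))
      (funext fun i => i.elim0)
  | inr c => rfl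

theorem incl_monadicTree (w : List T) : RTree.incl (V := Fin 0) H.ntRk (monadicTree w) =
    H.wordTree (w.map Sum.inr) (H.endTree (Sum.inl ())) := by
  induction w with
  | nil =>
    exact congrArg (RTree.node (rk := Sum.elim H.ntRk (monadicRk T)) (Sum.inr none))
      (funext fun i => i.elim0)
  | cons a w ih =>
    exact congrArg (RTree.node (rk := Sum.elim H.ntRk (monadicRk T)) (Sum.inr (some a)))
      (funext fun i => ih)

/-- The values of the derivation trees `d` and `d'` correspond to each other. -/
def Values (A : {A : List G.N // A ∈ G.big}) (τ : H.Assignment) (d : RTree G.ruleRk Empty)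
    (d' : RTree H.grammar.ruleRk Empty) : Prop :=
  ∀ C ∈ A.1, ∃ w : ℕ → List T,
    (G.val d C).word RTree.preorder =
      Word.interleave (fun j => (w j).map Sum.inr) (τ C).1 ∧
    ∀ j : Fin (b + 1), j.val ≤ (τ C).1.length →
      H.grammar.val d' (Sum.inr (Sum.inr (A, τ, C, j)) : H.Nt) =
        H.wordTree ((w j).map Sum.inr) (H.endTree (Sum.inr (Sum.inr (A, τ, C, j))))

/-- Let `θ` replace each component by the string it generates. Expanding a right-hand side into
components and then applying `θ` amounts to inserting the values of the subtrees, while `θ` is also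
the substitution made by the MCFG rule. As `θ` leaves the blocks alone, both sides have the same
pieces. -/
theorem exists_val_node {r : H.TypedRule} {start : Bool} (hr : r.Allowed start)
    {ρ' : H.grammar.RuleSym} (hρ' : ρ'.1 = r.rule start)
    (hrk : G.ruleRk r.1 = H.grammar.ruleRk ρ')
    {ds : Fin (G.ruleRk r.1) → RTree G.ruleRk Empty}
    {ds' : Fin (H.grammar.ruleRk ρ') → RTree H.grammar.ruleRk Empty}
    (h : ∀ i, Values (r.link i) (r.2 i) (ds i) (ds' (Fin.cast hrk i))) :
    ∃ θ : H.Comp ⊕ T → List T,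
      (∀ C ∈ r.1.1.lhs, (G.val (.node r.1 ds) C).word RTree.preorder =
        Word.interleave (fun j => ((r.piece C j).flatMap θ).map Sum.inr) (r.shape C).1) ∧
      ∀ c ∈ (r.rule start).lhs, H.grammar.val (.node ρ' ds') c =
        H.wordTree (((r.rhsPiece c).flatMap θ).map Sum.inr) (H.endTree c) := by
  -- The strings can be indexed by `D` alone, because the link containing `D` is unique.
  have hw (D : G.N) : ∃ w : ℕ → List T, ∀ i, D ∈ (r.link i).1 →
      (G.val (ds i) D).word RTree.preorder =
        Word.interleave (fun j => (w j).map Sum.inr) (r.2 i D).1 ∧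
      ∀ j : Fin (b + 1), j.val ≤ (r.2 i D).1.length →
        H.grammar.val (ds' (Fin.cast hrk i)) (Sum.inr (Sum.inr (r.link i, r.2 i, D, j)) : H.Nt) =
          H.wordTree ((w j).map Sum.inr)
            (H.endTree (Sum.inr (Sum.inr (r.link i, r.2 i, D, j)))) := by
    by_cases hD : ∃ i, D ∈ (r.link i).1
    · obtain ⟨i, hi⟩ := hD
      obtain ⟨w, hw⟩ := h i D hi
      refine ⟨w, fun i' hi' => ?_⟩
      obtain rfl := r.link_unique hi hi'
      exact hw
    · exact ⟨fun _ => [], fun i hi => absurd ⟨i, hi⟩ hD⟩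
  choose w hw hw' using hw
  refine ⟨Sum.elim (fun y => w y.2.2.1 y.2.2.2) fun a => [a], fun C hC => ?_, fun c hc => ?_⟩
  · set θ : H.Comp ⊕ T → List T := Sum.elim (fun y => w y.2.2.1 y.2.2.2) fun a => [a] with hθ
    have key (ω) (hω : ω ∈ (r.1.1.rhs C hC).symbols) :
        (G.valSubst r.1 ds ω).word RTree.preorder =
          Word.mapLetters (fun x => (θ x).map Sum.inr) (expand r.linkOf ω) := by
      cases ω with
      | inl D =>
        obtain ⟨i, hi⟩ := r.exists_link (List.mem_filterMap.2
          ⟨_, List.mem_flatMap.2 ⟨⟨C, hC⟩, List.mem_attach _ _, hω⟩, rfl⟩)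
        rw [G.valSubst_inl ds (i := i) hi, expand_of_eq_some (r.linkOf_eq hi)]
        refine (hw D i hi).trans (Eq.trans ?_ (Word.mapLetters_interleave _ _ _).symm)
        refine Word.interleave_congr fun j hj => ?_
        simp only [List.flatMap_singleton, hθ, Sum.elim_inl]
        rw [val_ofNat hj]
      | inr a =>
        have h' (l : List (Fin (rkT a))) : Word.bind (fun i => [Sum.inr i]) (l.map Sum.inr) =
            Word.mapLetters (fun x => (θ x).map (Sum.inr : T → G.N ⊕ T)) (l.map Sum.inr) := by
          induction l with
          | nil => rfl
          | cons i l ih => simpa using ih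
        exact congrArg (Sum.inl (Sum.inr a) :: ·) (h' (List.finRange (rkT a)))
    rw [G.val_node ds hC, RTree.word_hom, RTree.word_congr key, RTree.word_mapLetters]
    refine (congrArg _ (r.rhsWord_eq C hC)).trans ((Word.mapLetters_interleave _ _ _).trans ?_)
    simp only [List.map_flatMap]
  · have hc' : c ∈ ρ'.1.lhs := hρ' ▸ hc
    have hrhs : ρ'.1.rhs c hc' = H.wordTree (r.rhsPiece c) (H.endTree c) := by
      obtain ⟨ρ', h'⟩ := ρ'
      obtain rfl := hρ'
      rfl
    rw [H.grammar.val_node ds' hc', hrhs]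
    refine (hom_wordTree (r.rhsPiece c) _ (H.grammar.valSubst ρ' ds')
      (Sum.elim (fun y => w y.2.2.1 y.2.2.2) fun a => [a]) (fun y hy => ?_) (fun a => rfl) fun a => rfl).trans
      (congrArg _ (hom_endTree c (H.grammar.valSubst ρ' ds') fun a => rfl))
    have hy' : (Sum.inr (Sum.inr y) : H.Nt) ∈ (r.rule start).nonterminals := by
      rw [TypedRule.nonterminals_rule]
      exact List.mem_map.2 ⟨y, List.mem_flatMap.2 ⟨c, hc, mem_comps.2 hy⟩, rfl⟩
    obtain ⟨i, hi⟩ := (TypedRule.mem_nonterminals_rule hr).1 hy'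
    have hlink : ρ'.1.links.get (Fin.cast hrk i) = bigOf (r.link i) (r.2 i) := by
      obtain ⟨ρ', h'⟩ := ρ'
      obtain rfl := hρ'
      exact List.get_ofFn _ _
    refine (H.grammar.valSubst_inl ds' (i := Fin.cast hrk i) (hlink ▸ hi)).trans ?_
    obtain ⟨D, hD, j, hj, hy⟩ := mem_bigOf.1 hi
    simp only [Sum.inr.injEq] at hy
    subst hy
    exact hw' D i hD j hj

/-- The correspondence between values, where `start` indicates that the derivation tree `d'`
has the initial nonterminal as type. -/
def ValRel (A : {A : List G.N // A ∈ G.big}) (τ : H.Assignment) (d : RTree G.ruleRk Empty)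
    (d' : RTree H.grammar.ruleRk Empty) : Bool → Prop
  | true => ∃ t, G.HasValue d t ∧ H.grammar.HasValue d' (treeAsString t)
  | false => Values A τ d d'

/-- In the initial case the shape has no blocks, so the word of the value is a single string of
terminals; the value is therefore a terminal tree `t` with that string as `t.symbols`. -/
theorem valRel_node {r : H.TypedRule} {start : Bool} (hr : r.Allowed start)
    {ρ' : H.grammar.RuleSym} (hρ' : ρ'.1 = r.rule start)
    (hrk : G.ruleRk r.1 = H.grammar.ruleRk ρ')
    {ds : Fin (G.ruleRk r.1) → RTree G.ruleRk Empty}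
    {ds' : Fin (H.grammar.ruleRk ρ') → RTree H.grammar.ruleRk Empty}
    (h : ∀ i, Values (r.link i) (r.2 i) (ds i) (ds' (Fin.cast hrk i))) :
    ValRel r.lhs r.shape (.node r.1 ds) (.node ρ' ds') start := by
  obtain ⟨θ, h₁, h₂⟩ := exists_val_node hr hρ' hrk h
  cases start with
  | false =>
    intro C hC
    refine ⟨fun j => (r.piece C j).flatMap θ, h₁ C hC, fun j hj => ?_⟩
    exact h₂ _ (mem_bigOf.2 ⟨C, hC, j, hj, rfl⟩)
  | true =>
    have hS : G.S ∈ r.1.1.lhs := by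
      have hr : r.1.1.lhs = [G.S] := hr
      simp [hr]
    have hw := h₁ G.S hS
    have hsym := congrArg Word.letters hw
    rw [RTree.letters_word_preorder, Word.letters_interleave, TypedRule.shape_start] at hsym
    replace hsym : (G.val (.node r.1 ds) G.S).symbols =
      ((r.piece G.S 0).flatMap θ).map Sum.inr := by simpa using hsym
    have : IsEmpty (Fin (G.rkN G.S)) := by
      rw [G.S_rank]
      infer_instance
    obtain ⟨t, ht⟩ := RTree.exists_eq_incl G.rkN (G.val (.node r.1 ds) G.S) fun D hD => by
      simp [hsym] at hD
    refine ⟨t, ht, ?_⟩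
    rw [ht, RTree.symbols_incl] at hsym
    refine (h₂ _ (List.mem_singleton_self _)).trans ?_
    rw [treeAsString, List.map_injective_iff.2 Sum.inr_injective hsym]
    exact (incl_monadicTree _).symm

end ShapeSystem

end MCFTG

/-! ### Regularity -/

section Regular

variable {Ω : Type} {rk : Ω → ℕ}

/-- The state in which a deterministic bottom-up tree automaton ends. -/
def RTree.run {Q : Type} (δ : (ω : Ω) → (Fin (rk ω) → Q) → Q) : RTree rk Empty → Q
  | .var v => v.elim
  | .node ω ts => δ ω fun i => (ts i).run δ

/-- The regular tree grammar that simulates a deterministic bottom-up tree automaton. -/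
def RTG.ofRun {Q : Type} [Finite Q] (δ : (ω : Ω) → (Fin (rk ω) → Q) → Q) (q : Q) : RTG rk where
  N := Q
  finite_N := inferInstance
  S := q
  rules p ω ps := δ ω ps = p

theorem RTG.gen_ofRun {Q : Type} [Finite Q] (δ : (ω : Ω) → (Fin (rk ω) → Q) → Q) (q : Q)
    (p : (RTG.ofRun δ q).N) (t : RTree rk Empty) : (RTG.ofRun δ q).Gen p t ↔ t.run δ = p := by
  constructor
  · intro h
    induction h with
    | node p ω ps ts hr _ ih => exact (congrArg (δ ω) (funext ih)).trans hr
  · induction t generalizing p with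
    | var v => exact v.elim
    | node ω ts ih => exact fun h => .node (H := RTG.ofRun δ q) _ ω _ ts h fun i => ih i _ rfl

theorem isRegularTreeLanguage_run {Q : Type} [Finite Q]
    (δ : (ω : Ω) → (Fin (rk ω) → Q) → Q) (q : Q) :
    IsRegularTreeLanguage {t : RTree rk Empty | t.run δ = q} :=
  ⟨RTG.ofRun δ q, Set.ext fun t => (RTG.gen_ofRun δ q q t).symm⟩

theorem isRegularTreeLanguage_univ : IsRegularTreeLanguage (Set.univ : Set (RTree rk Empty)) := by
  have h : {t : RTree rk Empty | t.run (fun _ _ => ()) = ()} = Set.univ :=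
    Set.eq_univ_of_forall fun t => (rfl : t.run (fun _ _ => ()) = ())
  exact h ▸ isRegularTreeLanguage_run (rk := rk) (fun _ _ => ()) ()

theorem RTree.vars_node_var {Ω' V : Type} {rk' : Ω' → ℕ} (ω : Ω')
    (f : Fin (rk' ω) → V) :
    (RTree.node ω fun i => RTree.var (rk := rk') (f i)).vars = (List.finRange (rk' ω)).map f := by
  rw [RTree.vars_node, List.map_eq_flatMap]
  rfl

end Regular

/-! ### The two transducers. -/

namespace MCFTG.ShapeSystem

variable {T : Type} {rkT : T → ℕ} {G : MCFTG rkT} {b : ℕ} (H : G.ShapeSystem b)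

/-- The shapes of the value of a derivation tree. -/
noncomputable def shapesOf : RTree G.ruleRk Empty → H.Assignment :=
  RTree.run fun ρ σ => TypedRule.shape ⟨ρ, σ⟩

variable {H}

/-- The rule `r.rule start` as symbol of derivation trees. -/
noncomputable def sym (r : H.TypedRule) (start : Bool) (h : r.Allowed start) :
    H.grammar.RuleSym := ⟨r.rule start, H.mem_grammar_rules.2 ⟨r, start, h, rfl⟩⟩

theorem ruleRk_sym (r : H.TypedRule) (start : Bool) (h : r.Allowed start) :
    H.grammar.ruleRk (sym r start h) = G.ruleRk r.1 := H.length_links_rule r start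

/-- The transducer rule that applies to `ρ` if its subtrees have the shapes `σ`. -/
noncomputable def encodeRule (r : H.TypedRule) (start : Bool) (h : r.Allowed start) :
    LDTRRule Bool G.ruleRk H.grammar.ruleRk r.1 where
  lookRoot := Set.univ
  look i := {d | H.shapesOf d = r.2 i}
  out := .node (sym r start h) fun i => .var (false, Fin.cast (ruleRk_sym r start h) i)

theorem fst_of_mem_vars_encodeRule {r : H.TypedRule} {start : Bool} {h : r.Allowed start}
    {p : Bool × Fin (G.ruleRk r.1)} (hp : p ∈ (encodeRule r start h).out.vars) :
    p.1 = false := by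
  rw [encodeRule, RTree.vars_node_var] at hp
  obtain ⟨i, -, rfl⟩ := List.mem_map.1 hp
  rfl

theorem nodup_vars_encodeRule (r : H.TypedRule) (start : Bool) (h : r.Allowed start) :
    ((encodeRule r start h).out.vars.map Prod.snd).Nodup := by
  rw [encodeRule, RTree.vars_node_var, List.map_map]
  exact (List.nodup_finRange _).map (Fin.cast_injective (ruleRk_sym r start h))

variable (H)

/-- The transducer from the derivation trees of `G` to those of the MCFG. The state indicates
whether the output is to be a derivation tree for the initial nonterminal. -/
noncomputable def encode : LDTR G.ruleRk H.grammar.ruleRk where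
  Q := Bool
  finite_Q := inferInstance
  q₀ := true
  rules start ρ := {x | ∃ (σ : Fin (G.ruleRk ρ) → H.Assignment)
    (h : TypedRule.Allowed (H := H) ⟨ρ, σ⟩ start), x = encodeRule ⟨ρ, σ⟩ start h}
  finite_rules start ρ := by
    refine (Set.finite_range fun p : {σ : Fin (G.ruleRk ρ) → H.Assignment //
      TypedRule.Allowed (H := H) ⟨ρ, σ⟩ start} => encodeRule ⟨ρ, p.1⟩ start p.2).subset ?_
    rintro _ ⟨σ, h, rfl⟩
    exact ⟨⟨σ, h⟩, rfl⟩
  regular := by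
    rintro start ρ _ ⟨σ, h, rfl⟩
    exact ⟨isRegularTreeLanguage_univ, fun i => isRegularTreeLanguage_run _ (σ i)⟩
  linear := by
    rintro start ρ _ ⟨σ, h, rfl⟩
    exact nodup_vars_encodeRule ⟨ρ, σ⟩ start h
  deterministic := by
    rintro start ρ _ ⟨σ, h, rfl⟩ _ ⟨σ', h', rfl⟩ hne
    have hσ : σ ≠ σ' := by
      rintro rfl
      exact hne rfl
    obtain ⟨i, hi⟩ := Function.ne_iff.1 hσ
    refine Or.inr ⟨i, Set.disjoint_left.2 fun d hd hd' => hi ?_⟩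
    exact Eq.trans (Eq.symm hd) hd'

/-- A rule of `G` with shapes from which a given rule of the MCFG is made. -/
theorem exists_preimage (ρ' : H.grammar.RuleSym) :
    ∃ p : H.TypedRule × Bool, p.1.Allowed p.2 ∧ ρ'.1 = p.1.rule p.2 := by
  obtain ⟨r, start, h⟩ := H.mem_grammar_rules.1 ρ'.2
  exact ⟨(r, start), h⟩

/-- A choice of a preimage for each rule of the MCFG. -/
noncomputable def preimage (ρ' : H.grammar.RuleSym) : H.TypedRule × Bool :=
  (H.exists_preimage ρ').choose

theorem preimage_allowed (ρ' : H.grammar.RuleSym) :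
    (H.preimage ρ').1.Allowed (H.preimage ρ').2 := (H.exists_preimage ρ').choose_spec.1

theorem preimage_eq (ρ' : H.grammar.RuleSym) :
    ρ'.1 = (H.preimage ρ').1.rule (H.preimage ρ').2 := (H.exists_preimage ρ').choose_spec.2

theorem ruleRk_preimage (ρ' : H.grammar.RuleSym) :
    G.ruleRk (H.preimage ρ').1.1 = H.grammar.ruleRk ρ' :=
  (H.length_links_rule (H.preimage ρ').1 (H.preimage ρ').2).symm.trans
    (congrArg (fun ρ => ρ.links.length) (H.preimage_eq ρ')).symm

/-- The unique transducer rule for an input symbol `ρ'`. -/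
noncomputable def decodeRule (ρ' : H.grammar.RuleSym) :
    LDTRRule Unit H.grammar.ruleRk G.ruleRk ρ' where
  lookRoot := Set.univ
  look _ := Set.univ
  out := .node (H.preimage ρ').1.1 fun i => .var ((), Fin.cast (H.ruleRk_preimage ρ') i)

theorem nodup_vars_decodeRule (ρ' : H.grammar.RuleSym) :
    ((H.decodeRule ρ').out.vars.map Prod.snd).Nodup := by
  rw [decodeRule, RTree.vars_node_var, List.map_map]
  exact (List.nodup_finRange _).map (Fin.cast_injective (H.ruleRk_preimage ρ'))

/-- The transducer from the derivation trees of the MCFG to those of `G`. -/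
noncomputable def decode : LDTR H.grammar.ruleRk G.ruleRk where
  Q := Unit
  finite_Q := inferInstance
  q₀ := ()
  rules _ ρ' := {H.decodeRule ρ'}
  finite_rules _ _ := Set.finite_singleton _
  regular := by
    rintro _ ρ' _ rfl
    exact ⟨isRegularTreeLanguage_univ, fun i => isRegularTreeLanguage_univ⟩
  linear := by
    rintro _ ρ' _ rfl
    exact H.nodup_vars_decodeRule ρ'
  deterministic := by
    rintro _ ρ' _ rfl _ rfl hne
    exact absurd rfl hne

variable {H}

/-- The types of derivation trees of the MCFG. -/
def typeOf (A : {A : List G.N // A ∈ G.big}) (τ : H.Assignment) (start : Bool) :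
    H.grammar.der.N :=
  ⟨if start then [Sum.inl ()] else bigOf A τ, H.mem_grammar_big.2 (by
    cases start
    · exact Or.inr (Or.inr ⟨A, τ, rfl⟩)
    · exact Or.inl rfl)⟩

/-- Hence the copies that `Allowed` drops are never needed below the root. -/
theorem not_startSeparated_of_link (r : H.TypedRule) (i) :
    ¬ (G.StartSeparated ∧ (r.link i).1 = [G.S]) := fun h =>
  h.1 _ r.1.2 (r.mem_nonterminals (i := i) (by simp [h.2]))

/-- The shapes of the subtrees make the root rule a typed rule, whose own shapes are those of the
whole tree by definition of `shapesOf`; the look-ahead selects exactly this typed rule. -/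
theorem exists_encode {A : G.der.N} {d : RTree G.ruleRk Empty} (hd : G.der.Gen A d)
    (start : Bool)
    (hA : match start with
      | true => A.1 = [G.S]
      | false => ¬ (G.StartSeparated ∧ A.1 = [G.S])) :
    ∃ d', H.grammar.der.Gen (typeOf A (H.shapesOf d) start) d' ∧
      H.encode.Translates start d d' ∧ ValRel A (H.shapesOf d) d d' start := by
  induction hd generalizing start with
  | node A ρ Bs ds hr hds ih =>
    let r : H.TypedRule := ⟨ρ, fun i => H.shapesOf (ds i)⟩
    have hBs (i) : Bs i = r.link i := Subtype.ext (hr.2 i)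
    obtain rfl : r.lhs = A := Subtype.ext hr.1
    have h : r.Allowed start := by cases start <;> exact hA
    choose ds' hgen htrans hval using fun i => ih i false (by
      simpa only [hBs i] using not_startSeparated_of_link r i)
    refine ⟨.node (sym r start h) fun i => ds' (Fin.cast (ruleRk_sym r start h) i), ?_, ?_, ?_⟩
    · refine .node _ _ (fun i => typeOf (Bs (Fin.cast (ruleRk_sym r start h) i))
        (H.shapesOf (ds (Fin.cast (ruleRk_sym r start h) i))) false) _ ⟨rfl, fun i => ?_⟩
        fun i => hgen _
      refine Eq.trans ?_ (List.get_ofFn _ _).symm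
      change bigOf (Bs _) _ = bigOf (r.link _) _
      rw [hBs]
      rfl
    · refine .step (M := H.encode) start ρ ds (encodeRule r start h) ⟨_, h, rfl⟩ trivial
        (fun i => rfl) (fun p => ds' p.2) ?_
      rintro ⟨q, i⟩ hp
      obtain rfl : q = false := fst_of_mem_vars_encodeRule (r := r) hp
      exact htrans i
    · refine valRel_node h rfl (ruleRk_sym r start h).symm fun i => ?_
      rw [← hBs i]
      exact hval i

/-- An MCFG rule comes from a typed rule, so erasing shapes needs no look-ahead. Its left-hand side
and links fix the types of the chosen preimage; for the initial type `τ` is irrelevant. -/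
theorem exists_decode {A' : H.grammar.der.N} {d' : RTree H.grammar.ruleRk Empty}
    (hd' : H.grammar.der.Gen A' d') {A : {A : List G.N // A ∈ G.big}} {τ : H.Assignment}
    {start : Bool} (hA' : A' = typeOf A τ start) (hA : start = true → A.1 = [G.S]) :
    ∃ d, G.der.Gen A d ∧ H.decode.Translates () d' d ∧ ValRel A τ d d' start := by
  induction hd' generalizing A τ start with
  | node A' ρ' Bs ds' hr hds ih =>
    have hallowed := H.preimage_allowed ρ'
    have heq := H.preimage_eq ρ'
    have hrk := H.ruleRk_preimage ρ'
    set r := (H.preimage ρ').1 with hr_def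
    have hlhs : (r.rule (H.preimage ρ').2).lhs = (typeOf A τ start).1 := by
      rw [← heq, ← hA']
      exact hr.1
    have hne {A : {A : List G.N // A ∈ G.big}} {τ : H.Assignment} :
        [(Sum.inl () : H.Nt)] ≠ bigOf A τ := fun hAτ => by
      obtain ⟨C, -, j, -, h⟩ := mem_bigOf.1 (hAτ ▸ List.mem_singleton_self _)
      cases h
    have hstart : (H.preimage ρ').2 = start ∧ r.lhs = A ∧ (start = false → r.shape = τ) := by
      cases hs : (H.preimage ρ').2 <;> rw [hs] at hlhs hallowed <;> cases start
      · obtain ⟨h₁, h₂⟩ := bigOf_injective hlhs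
        exact ⟨rfl, h₁, fun _ => h₂⟩
      · exact absurd hlhs.symm hne
      · exact absurd hlhs hne
      · exact ⟨rfl, Subtype.ext (Eq.trans hallowed (hA rfl).symm), fun h => nomatch h⟩
    obtain ⟨hs, rfl, hτ⟩ := hstart
    rw [hs] at heq hallowed
    have hlink (i : Fin (G.ruleRk r.1)) :
        Bs (Fin.cast hrk i) = typeOf (r.link i) (r.2 i) false := by
      refine Subtype.ext ((hr.2 _).trans ?_)
      -- Forgetting that `r` was chosen from `ρ'` makes it possible to substitute along `heq`.
      clear_value r
      obtain ⟨ρ', h'⟩ := ρ'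
      obtain rfl := heq
      exact List.get_ofFn _ _
    choose ds hgen htrans hval using fun i => ih (Fin.cast hrk i) (hlink i) (fun h => nomatch h)
    refine ⟨.node r.1 ds, .node _ _ r.link _ ⟨rfl, fun i => rfl⟩ hgen, ?_, ?_⟩
    · refine .step (M := H.decode) () ρ' ds' (H.decodeRule ρ') rfl trivial (fun i => trivial)
        (fun p => ds (Fin.cast hrk.symm p.2)) ?_
      exact fun p _ => htrans (Fin.cast hrk.symm p.2)
    · have hv := valRel_node hallowed heq hrk hval
      cases start with
      | true => exact hv
      | false => rwa [hτ rfl] at hv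

theorem ldtrEquivalent_grammar (H : G.ShapeSystem b) : LDTREquivalent treeAsString G H.grammar := by
  refine ⟨⟨H.encode, fun d hd => ?_⟩, H.decode, fun d' hd' => ?_⟩
  · obtain ⟨d', hd', htrans, t, ht, ht'⟩ := exists_encode (H := H) hd true rfl
    exact ⟨d', hd', htrans, t, _, ht, ht', rfl⟩
  · obtain ⟨d, hd, htrans, t, ht, ht'⟩ := exists_decode (H := H) hd'
      (A := ⟨[G.S], G.S_big⟩) (τ := H.someShape) (start := true) rfl fun _ => rfl
    exact ⟨d, hd, htrans, _, t, ht', ht, rfl⟩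

theorem exists_mcfg (H : G.ShapeSystem b) : ∃ G' : MCFTG (monadicRk T), G'.IsMCFG ∧
      LDTREquivalent treeAsString G G' ∧
      (G.StartSeparated → ∀ Δ : Set T, G.IsLexicalized Δ → G'.IsLexicalized (some '' Δ)) ∧
      G'.multiplicity = G.multiplicity * (b + 1) ∧ G'.ruleWidth = G.ruleWidth :=
  ⟨H.grammar, H.isMCFG_grammar, H.ldtrEquivalent_grammar,
    fun h _ hΔ => H.isLexicalized_grammar h hΔ, H.multiplicity_grammar, H.ruleWidth_grammar⟩

end ShapeSystem

end MCFTG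

/-! ### The two shape systems -/

theorem RTree.IsPattern.vars_perm {Ω : Type} {rk : Ω → ℕ} {k : ℕ} {t : RTree rk (Fin k)}
    (ht : t.IsPattern) : t.vars.Perm (List.finRange k) :=
  (List.perm_ext_iff_of_nodup ht.1 (List.nodup_finRange k)).2 fun i => by simp [ht.2 i]

/-- A foot node contributes the contiguous block x_1 ⋯ x_k, and the symbols above it only add words
on both sides, since no `E ω` omits a variable. -/
theorem RTree.HasFoot.exists_word {Ω X : Type} {rk : Ω → ℕ} {k : ℕ}
    {E : (ω : Ω) → Word X (Fin (rk ω))} (hE : ∀ ω i, Sum.inr i ∈ E ω)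
    (hk : ∀ ω, rk ω = k → ∃ p q : Word X (Fin (rk ω)), E ω = p ++ (List.finRange (rk ω)).map Sum.inr ++ q)
    {t : RTree rk (Fin k)} (ht : t.HasFoot) :
    ∃ p q : Word X (Fin k), t.word E = p ++ (List.finRange k).map Sum.inr ++ q := by
  induction t with
  | var v => exact ht.elim
  | node ω ts ih =>
    rcases ht with ⟨rfl, ht⟩ | ⟨i, hi⟩
    · obtain ⟨p, q, h⟩ := hk ω rfl
      have hts (i) : ts i = var i := by
        obtain ⟨j, hj, h⟩ := ht i
        rw [h, Fin.ext hj]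
      have hid (l : Word X (Fin (rk ω))) : Word.bind (fun i => (ts i).word E) l = l := by
        simp only [hts, word]
        induction l with
        | nil => rfl
        | cons z l ih => cases z <;> simp [ih]
      exact ⟨p, q, (hid _).trans h⟩
    · obtain ⟨p, q, h⟩ := ih i hi
      obtain ⟨l, l', hl⟩ := List.append_of_mem (hE ω i)
      refine ⟨Word.bind (fun i => (ts i).word E) l ++ p,
        q ++ Word.bind (fun i => (ts i).word E) l', ?_⟩
      rw [word, hl, Word.bind_append, Word.bind_inr, h]
      simp only [List.append_assoc]

namespace MCFTG

variable {T : Type} {rkT : T → ℕ} (G : MCFTG rkT)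

theorem vars_perm_of_interleave {G : MCFTG rkT} {X : Type}
    {E : (ω : G.N ⊕ T) → Word X (Fin (Sum.elim G.rkN rkT ω))}
    (hN : ∀ D, ∃ s : List (List (Fin (G.rkN D))), s.flatten.Perm (List.finRange (G.rkN D)) ∧
      ∃ w, E (Sum.inl D) = Word.interleave w s)
    (hT : ∀ a, ∃ x, E (Sum.inr a) = Sum.inl x :: (List.finRange (rkT a)).map Sum.inr)
    (ω : G.N ⊕ T) : (E ω).vars.Perm (List.finRange (Sum.elim G.rkN rkT ω)) := by
  cases ω with
  | inl D =>
    obtain ⟨s, hs, w, h⟩ := hN D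
    exact (List.Perm.of_eq ((congrArg Word.vars h).trans (Word.vars_interleave w s))).trans hs
  | inr a =>
    obtain ⟨x, h⟩ := hT a
    exact List.Perm.of_eq ((congrArg Word.vars h).trans (by simp))

/-- The shapes all of whose blocks have length one. -/
def permShapes : G.ShapeSystem G.width where
  shapes C := {s | ∃ l : List (Fin (G.rkN C)), l.Perm (List.finRange _) ∧
    s = l.map fun v => [v]}
  finite C := by
    refine ((List.finRange (G.rkN C)).permutations.toFinset.finite_toSet.image
      fun l => l.map fun v => [v]).subset ?_
    rintro _ ⟨l, hl, rfl⟩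
    exact ⟨l, by simpa using hl, rfl⟩
  nonempty C := ⟨_, _, List.Perm.refl _, rfl⟩
  perm := by
    rintro C _ ⟨l, hl, rfl⟩
    simpa [← List.flatMap_def] using hl
  length_le := by
    rintro C _ ⟨l, hl, rfl⟩
    let := G.fintype_N
    rw [List.length_map, hl.length_eq, List.length_finRange]
    exact Finset.le_sup (f := G.rkN) (Finset.mem_univ C)
  nil_of_start := by
    rintro _ ⟨l, hl, rfl⟩
    have h := (hl.length_eq.trans List.length_finRange).trans G.S_rank
    rw [List.eq_nil_of_length_eq_zero h, List.map_nil]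
  exists_interleave ρ hρ C hC X E hN hT := by
    have hE := vars_perm_of_interleave (fun D => by
      obtain ⟨_, ⟨l, hl, rfl⟩, h⟩ := hN D
      exact ⟨_, by simpa [← List.flatMap_def] using hl, h⟩) hT
    -- Every order of the variables is an allowed shape, so being a pattern suffices.
    exact ⟨_, ⟨_, (RTree.vars_word hE _).trans (G.rhs_pattern ρ hρ C hC).vars_perm, rfl⟩,
      Word.exists_eq_interleave _⟩

/-- The shape with one block that consists of all variables, in order. -/
def footShape (k : ℕ) : List (List (Fin k)) := if k = 0 then [] else [List.finRange k]

theorem flatten_footShape (k : ℕ) : (footShape k).flatten = List.finRange k := by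
  rcases k with _ | k <;> simp [footShape]

/-- The shapes of footed patterns. -/
def footShapes (hG : G.IsFooted) : G.ShapeSystem 1 where
  shapes C := {footShape (G.rkN C)}
  finite C := Set.finite_singleton _
  nonempty C := Set.singleton_nonempty _
  perm := by
    rintro C _ rfl
    rw [flatten_footShape]
  length_le := by
    rintro C _ rfl
    unfold footShape
    split_ifs <;> simp
  nil_of_start := by
    rintro _ rfl
    -- In rank 0 the shape is `[]` rather than `[[]]`, so there is only one piece.
    exact if_pos G.S_rank
  exists_interleave ρ hρ C hC X E hN hT := by
    refine ⟨_, rfl, ?_⟩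
    have hE := vars_perm_of_interleave (fun D => by
      obtain ⟨_, rfl, h⟩ := hN D
      exact ⟨_, List.Perm.of_eq (flatten_footShape _), h⟩) hT
    have hvars := (RTree.vars_word hE _).trans (G.rhs_pattern ρ hρ C hC).vars_perm
    have hnil {V : Type} {l : Word X V} (h : l.vars = []) : ∃ w : List X, l = w.map Sum.inl := by
      obtain ⟨w, hw⟩ := Word.exists_eq_interleave l
      rw [h] at hw
      exact ⟨w 0, hw⟩
    by_cases hk : G.rkN C = 0
    · have h := (hvars.length_eq.trans List.length_finRange).trans hk
      obtain ⟨w, hw⟩ := hnil (List.eq_nil_of_length_eq_zero h)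
      exact ⟨fun _ => w, by rw [hw, footShape, if_pos hk]; rfl⟩
    · obtain ⟨p, q, h⟩ := RTree.HasFoot.exists_word
        (fun ω i => Word.mem_vars.1 ((hE ω).mem_iff.2 (List.mem_finRange i))) (fun ω hω => by
          cases ω with
          | inl D =>
            obtain ⟨_, rfl, w, h⟩ := hN D
            have hD : G.rkN D ≠ 0 := fun h => hk (hω.symm.trans h)
            rw [footShape, if_neg hD] at h
            exact ⟨_, _, h⟩
          | inr a =>
            obtain ⟨x, h⟩ := hT a
            exact ⟨[Sum.inl x], [], h.trans (List.append_nil _).symm⟩) ((hG ρ hρ C hC).resolve_left hk)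
      -- The block accounts for all occurrences of variables, so none remain in `p` and `q`.
      have hlen := hvars.length_eq
      rw [h, Word.vars_append, Word.vars_append, Word.vars_map_inr, List.length_append,
        List.length_append] at hlen
      obtain ⟨w, rfl⟩ := hnil (List.eq_nil_of_length_eq_zero (l := p.vars) (by lia))
      obtain ⟨w', rfl⟩ := hnil (List.eq_nil_of_length_eq_zero (l := q.vars) (by lia))
      refine ⟨fun j => if j = 0 then w else w', ?_⟩
      rw [h, footShape, if_neg hk]
      rfl

end MCFTG

theorem mainTheorem8 {T : Type} (rkT : T → ℕ) (G : MCFTG rkT) :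
    (∃ G' : MCFTG (monadicRk T), G'.IsMCFG ∧
      MCFTG.LDTREquivalent treeAsString G G' ∧
      (G.StartSeparated → ∀ Δ : Set T, G.IsLexicalized Δ → G'.IsLexicalized (some '' Δ)) ∧
      G'.multiplicity = G.multiplicity * (G.width + 1) ∧
      G'.ruleWidth = G.ruleWidth) ∧
    (G.IsFooted → ∃ G' : MCFTG (monadicRk T), G'.IsMCFG ∧
      MCFTG.LDTREquivalent treeAsString G G' ∧
      (G.StartSeparated → ∀ Δ : Set T, G.IsLexicalized Δ → G'.IsLexicalized (some '' Δ)) ∧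
      G'.multiplicity = 2 * G.multiplicity ∧
      G'.ruleWidth = G.ruleWidth) := by
  refine ⟨MCFTG.ShapeSystem.exists_mcfg G.permShapes, fun hG => ?_⟩
  rw [Nat.mul_comm]
  exact MCFTG.ShapeSystem.exists_mcfg (G.footShapes hG)
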